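/- Conventions. Let $y:M^n\to\mathbb R^{n+1}$ be a nondegenerate hypersurface with local coordinates $(u^i)$. Put $h_{ij}=\pm\det(\partial_1y,\dots,\partial_ny,\partial_i\partial_jy)$, where the sign is fixed by a choice of co-orientation, $H=|\det(h_{ij})|$, and let $g_{ij}=H^{-1/(n+2)}h_{ij}$ be the affine metric and $\xi=\frac1n\Delta_g y$ the affine normal. Let $e_{n+1}=H^{-1/(n+2)}\xi$, and write $\omega^j_i,\omega^{n+1}_{n+1}$ for the connection forms of the frame $(\partial_1 y,\dots,\partial_n y,e_{n+1})$. The Fubini–Pick form is $A_{ijk}=-\frac12H^{-1/(n+2)}h_{ijk}$, where $\sum_k h_{ijk}\,du^k=dh_{ij}+h_{ij}\,\omega^{n+1}_{n+1}-\sum_kh_{kj}\,\omega^k_i-\sum_kh_{ik}\,\omega^k_j$. The hypersurface $y$ is a hyperbolic affine hypersphere with affine mean curvature $L<0$ and affine center the origin if its affine shape operator is $L\cdot\mathrm{id}$ and all its affine normal lines pass through the origin; then $\xi=-Ly$, and the co-orientation is the one given by the position vector $y$. A $0$-dimensional hyperbolic affine hypersphere is by convention the point $1\in\mathbb R$, with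 affine mean curvature $-1$. Let $K\ge2$, let $n_1,\dots,n_K\ge0$ be integers and let $x_a:M^{n_a}\to\mathbb R^{n_a+1}$ ($1\le a\le K$) be smooth hyperbolic affine hyperspheres with affine mean curvatures $L_1^{(a)}<0$ and with the origin as common affine center. Let $c_1,\dots,c_K>0$. Put $f_a=n_1+\dots+n_a+a$, $n=f_K-1$, $$e_a=\exp\Big(-\frac{t^{a-1}}{n_a+1}+\sum_{\lambda=a}^{K-1}\frac{t^\lambda}{f_\lambda}\Big)\quad(\text{without the first term if }a=1),$$ $$C=\Big(\frac1{f_K}\prod_{a=1}^K\frac{c_a^{2(n_a+1)}}{(n_a+1)^{n_a+1}(-L_1^{(a)})^{n_a+2}}\Big)^{\frac1{n+2}}.$$ Let $$x:\mathbb R^{K-1}\times M^{n_1}\times\dots\times M^{n_K}\to\mathbb R^{n+1},\qquad x(t,p_1,\dots,p_K)=(c_1e_1x_1(p_1),\dots,c_Ke_Kx_K(p_K)),$$ be the Calabi composition. It is a hyperbolic affine hypersphere with the origin as its affine center and with affine mean curvature $-\frac1{f_KC}$. Let $(v^{i_a})_{1\le i_a\le n_a}$ be any local coordinates on $M^{n_a}$,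 and use on the product the coordinates $u^\lambda=t^\lambda$ ($1\le\lambda\le K-1$) and $u^{\bar i_a}=v^{i_a}$. Let $g$, $A$ be the affine metric and the Fubini–Pick form of $x$, and $g^{(a)}$, $A^{(a)}$ those of $x_a$. Then $A$ is symmetric, and for all $a$, $i_a,j_a,k_a$, $\lambda,\mu$ $$A_{\lambda\lambda\lambda}=\frac{f_{\lambda+1}C}{(n_{\lambda+1}+1)f_\lambda}\Big(\frac1{f_\lambda}-\frac1{n_{\lambda+1}+1}\Big),\qquad A_{\lambda\lambda\mu}=\frac{f_{\lambda+1}C}{(n_{\lambda+1}+1)f_\lambda f_\mu}\quad(\lambda<\mu),$$ $$A_{\bar i_a\bar j_a\,a-1}=-\frac1{n_a+1}\,g_{\bar i_a\bar j_a}=L_1^{(a)}C\,g^{(a)}_{i_aj_a}\quad(a\ge2),$$ $$A_{\bar i_a\bar j_a\lambda}=\frac1{f_\lambda}\,g_{\bar i_a\bar j_a}=\frac{(n_a+1)(-L_1^{(a)})C}{f_\lambda}\,g^{(a)}_{i_aj_a}\quad(\lambda\ge a),$$ $$A_{\bar i_a\bar j_a\bar k_a}=(n_a+1)(-L_1^{(a)})\,C\,A^{(a)}_{i_aj_ak_a}.$$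 All components of $A$ whose index triple is not a permutation of one of those listed here vanish. -/

import Mathlib

open scoped ContDiff Manifold

namespace AffineHypersurface

noncomputable section

/-! Equiaffine geometry of a parametrised hypersurface.  The coordinates `u^i` are indexed by a
finite type `ι`, the ambient space is `κ → ℝ`, and `e : Option ι ≃ κ` fixes the order in which the
vectors of a frame `(v_i)_{i : ι}, w` are put into the ambient determinant. -/

variable {ι κ : Type*} [Fintype ι] [DecidableEq ι] [Fintype κ] [DecidableEq κ]

/-- The partial derivative `∂f/∂u^i` at `u`. -/
def pd {F : Type*} [NormedAddCommGroup F] [NormedSpace ℝ F]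
    (i : ι) (f : (ι → ℝ) → F) (u : ι → ℝ) : F :=
  fderiv ℝ f u (Pi.single i 1)

/-- The matrix whose rows are the vectors `∂y/∂u^i` (`i : ι`) and `w`. -/
def frameMatrix (e : Option ι ≃ κ) (y : (ι → ℝ) → κ → ℝ) (u : ι → ℝ) (w : κ → ℝ) :
    Matrix κ κ ℝ :=
  Matrix.of fun k => (e.symm k).elim w fun i => pd i y u

/-- `det(∂y/∂u^1, …, ∂y/∂u^n, w)`. -/
def frameDet (e : Option ι ≃ κ) (y : (ι → ℝ) → κ → ℝ) (u : ι → ℝ) (w : κ → ℝ) : ℝ :=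
  (frameMatrix e y u w).det

/-- `h_{ij} = det(∂y/∂u^1, …, ∂y/∂u^n, ∂²y/∂u^i∂u^j)`.  The overall sign, which depends on the
orientations, is fixed by a vector field `ν` along `y`: the coefficient is positive for second
derivatives that point to the side of `ν`. -/
def secondForm (e : Option ι ≃ κ) (ν y : (ι → ℝ) → κ → ℝ) (u : ι → ℝ) : Matrix ι ι ℝ :=
  Matrix.of fun i j => Real.sign (frameDet e y u (ν u)) * frameDet e y u (pd i (pd j y) u)

/-- `H = |det (h_{ij})|`. -/
def absDet (e : Option ι ≃ κ) (ν y : (ι → ℝ) → κ → ℝ) (u : ι → ℝ) : ℝ :=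
  |(secondForm e ν y u).det|

/-- The affine (Berwald–Blaschke) metric `g_{ij} = H^{-1/(n+2)} h_{ij}`. -/
def affineMetric (e : Option ι ≃ κ) (ν y : (ι → ℝ) → κ → ℝ) (u : ι → ℝ) : Matrix ι ι ℝ :=
  (absDet e ν y u ^ (-(1 / ((Fintype.card ι : ℝ) + 2)))) • secondForm e ν y u

/-- The Laplacian of a (vector valued) function `f` with respect to a pseudo-Riemannian metric `g`:
`Δ_g f = |G|^{-1/2} ∑_{ij} ∂_i (|G|^{1/2} g^{ij} ∂_j f)`, `G = det (g_{ij})`. -/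
def laplacian {F : Type*} [NormedAddCommGroup F] [NormedSpace ℝ F]
    (g : (ι → ℝ) → Matrix ι ι ℝ) (f : (ι → ℝ) → F) (u : ι → ℝ) : F :=
  (1 / √|(g u).det|) •
    ∑ i, ∑ j, pd i (fun v => (√|(g v).det| * (g v)⁻¹ i j) • pd j f v) u

/-- The affine normal `ξ = (1/n) Δ_g y`. -/
def affineNormal (e : Option ι ≃ κ) (ν y : (ι → ℝ) → κ → ℝ) (u : ι → ℝ) : κ → ℝ :=
  (1 / (Fintype.card ι : ℝ)) • laplacian (affineMetric e ν y) y u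

/-- The vector `e_{n+1} = H^{-1/(n+2)} ξ`, parallel to the affine normal, for which the frame
`(∂y/∂u^1, …, ∂y/∂u^n, e_{n+1})` is unimodular. -/
def unimodularNormal (e : Option ι ≃ κ) (ν y : (ι → ℝ) → κ → ℝ) (u : ι → ℝ) : κ → ℝ :=
  (absDet e ν y u ^ (-(1 / ((Fintype.card ι : ℝ) + 2)))) • affineNormal e ν y u

/-- The coefficients of a vector `w` in the frame `(∂y/∂u^1, …, ∂y/∂u^n, e_{n+1})` at `u`; the index
`none` stands for `e_{n+1}`. -/
def frameCoord (e : Option ι ≃ κ) (ν y : (ι → ℝ) → κ → ℝ) (u : ι → ℝ) (w : κ → ℝ)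
    (o : Option ι) : ℝ :=
  Matrix.vecMul w (frameMatrix e y u (unimodularNormal e ν y u))⁻¹ (e o)

/-- The coefficients `Γ^k_{ij}` of the induced affine connection: `∂_i∂_j y = Γ^k_{ij} ∂_k y`
modulo the affine normal.  In terms of connection forms, `ω^k_j = Γ^k_{ij} du^i`. -/
def connCoeff (e : Option ι ≃ κ) (ν y : (ι → ℝ) → κ → ℝ) (u : ι → ℝ) (k i j : ι) : ℝ :=
  frameCoord e ν y u (pd i (pd j y) u) (some k)

/-- The value of the connection form `ω^{n+1}_{n+1}` on `∂/∂u^k`. -/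
def normalConn (e : Option ι ≃ κ) (ν y : (ι → ℝ) → κ → ℝ) (u : ι → ℝ) (k : ι) : ℝ :=
  frameCoord e ν y u (pd k (unimodularNormal e ν y) u) none

/-- `∑_k h_{ijk} du^k = dh_{ij} + h_{ij} ω^{n+1}_{n+1} - ∑_l h_{lj} ω^l_i - ∑_l h_{il} ω^l_j`. -/
def thirdForm (e : Option ι ≃ κ) (ν y : (ι → ℝ) → κ → ℝ) (u : ι → ℝ) (i j k : ι) : ℝ :=
  pd k (fun v => secondForm e ν y v i j) u
    + secondForm e ν y u i j * normalConn e ν y u k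
    - ∑ l, secondForm e ν y u l j * connCoeff e ν y u l k i
    - ∑ l, secondForm e ν y u i l * connCoeff e ν y u l k j

/-- The components `A_{ijk} = -(1/2) H^{-1/(n+2)} h_{ijk}` of the Fubini–Pick form. -/
def fubiniPick (e : Option ι ≃ κ) (ν y : (ι → ℝ) → κ → ℝ) (u : ι → ℝ) (i j k : ι) : ℝ :=
  -(1 / 2) * absDet e ν y u ^ (-(1 / ((Fintype.card ι : ℝ) + 2))) * thirdForm e ν y u i j k

/-- On the open set `U`, the parametrised hypersurface `y` is a hyperbolic affine hypersphere with
affine mean curvature `L < 0` and with the origin as its affine center: it is nondegenerate, its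
affine shape operator `B` (`∂_i ξ = - ∂_{B(∂_i)} y`) is `L · id`, and all affine normal lines
pass through the origin.  Since then `ξ = -L y` with `-L > 0`, the position vector is on the same
side as the affine normal; therefore the sign of `h_{ij}` is the one fixed by `ν = y`. -/
structure IsHyperbolicHypersphereOn (e : Option ι ≃ κ) (y : (ι → ℝ) → κ → ℝ)
    (U : Set (ι → ℝ)) (L : ℝ) : Prop where
  neg : L < 0
  smooth : ContDiffOn ℝ ∞ y U
  nondegenerate : ∀ u ∈ U, (secondForm e y y u).det ≠ 0
  shape : ∀ u ∈ U, ∀ i, pd i (affineNormal e y y) u = -(L • pd i y u)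
  center : ∀ u ∈ U, ∃ s : ℝ, y u + s • affineNormal e y y u = 0

/-- The frame order `(v_1, …, v_n, w)` in `ℝ^{n+1}`. -/
def stdOrder (n : ℕ) : Option (Fin n) ≃ Fin (n + 1) := finSuccEquivLast.symm

/-- `x : M^n → ℝ^{n+1}` is a hyperbolic affine hypersphere with affine mean curvature `L` and the
origin as its affine center.  In dimension `0` this means, by convention, the point `1` of `ℝ`, with
affine mean curvature `-1`. -/
structure IsHyperbolicHypersphere (n : ℕ) {M : Type*} [TopologicalSpace M]
    [ChartedSpace (Fin n → ℝ) M] (x : M → Fin (n + 1) → ℝ) (L : ℝ) : Prop where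
  smooth : ContMDiff 𝓘(ℝ, Fin n → ℝ) 𝓘(ℝ, Fin (n + 1) → ℝ) ∞ x
  hypersphere : 0 < n → ∀ φ ∈ IsManifold.maximalAtlas 𝓘(ℝ, Fin n → ℝ) ∞ M,
    IsHyperbolicHypersphereOn (stdOrder n) (x ∘ φ.symm) φ.target L
  point : n = 0 → (∀ p, x p = fun _ => 1) ∧ L = -1

/-! The Calabi composition.  The factors are numbered by `a : Fin K`, so `a.val + 1` is the usual
number; the parameters `t^λ`, `1 ≤ λ ≤ K - 1`, are numbered by `l : Fin (K - 1)`, with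
`λ = l.val + 1`. -/

/-- `f_m = n_1 + ⋯ + n_m + m`. -/
def calabiF {K : ℕ} (n : Fin K → ℕ) (m : ℕ) : ℝ :=
  ∑ b : Fin K, if b.val < m then (n b : ℝ) + 1 else 0

/-- `e_a = exp(-t^{a-1}/(n_a+1) + t^a/f_a + ⋯ + t^{K-1}/f_{K-1})`; the first term is absent for the
first factor. -/
def calabiE {K : ℕ} (n : Fin K → ℕ) (t : Fin (K - 1) → ℝ) (a : Fin K) : ℝ :=
  Real.exp (∑ l : Fin (K - 1),
    if l.val + 1 = a.val then -(t l / ((n a : ℝ) + 1))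
    else if a.val ≤ l.val then t l / calabiF n (l.val + 1) else 0)

/-- The Calabi composition `x(t, p_1, …, p_K) = (c_1 e_1 x_1(p_1), …, c_K e_K x_K(p_K))`. -/
def calabiComposition {K : ℕ} (n : Fin K → ℕ) {M : Fin K → Type*} (c : Fin K → ℝ)
    (x : ∀ a, M a → Fin (n a + 1) → ℝ) (q : (Fin (K - 1) → ℝ) × (∀ a, M a)) :
    (Σ a, Fin (n a + 1)) → ℝ :=
  fun k => c k.1 * calabiE n q.1 k.1 * x k.1 (q.2 k.1) k.2

/-- The constant `C`, with `n + 2 = f_K + 1`. -/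
def calabiC {K : ℕ} (n : Fin K → ℕ) (c L : Fin K → ℝ) : ℝ :=
  ((calabiF n K)⁻¹ * ∏ a, c a ^ (2 * (n a + 1)) /
    (((n a : ℝ) + 1) ^ (n a + 1) * (-L a) ^ (n a + 2))) ^ (1 / (calabiF n K + 1))

/-- The index set of the coordinates `u^λ = t^λ` and `u^{ī_a} = v^{i_a}` on
`ℝ^{K-1} × M^{n_1} × ⋯ × M^{n_K}`. -/
abbrev CalabiIndex {K : ℕ} (n : Fin K → ℕ) : Type := Fin (K - 1) ⊕ (Σ a : Fin K, Fin (n a))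

/-- The index `λ`. -/
abbrev tIdx {K : ℕ} {n : Fin K → ℕ} (l : Fin (K - 1)) : CalabiIndex n := Sum.inl l

/-- The index `ī_a`. -/
abbrev vIdx {K : ℕ} {n : Fin K → ℕ} (a : Fin K) (i : Fin (n a)) : CalabiIndex n := Sum.inr ⟨a, i⟩

/-- The coordinates of the `a`-th factor. -/
def factorCoord {K : ℕ} {n : Fin K → ℕ} (u : CalabiIndex n → ℝ) (a : Fin K) : Fin (n a) → ℝ :=
  fun i => u (vIdx a i)

/-- The inverse of the product chart given by the coordinates `t` and the charts `φ_a`. -/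
def productParam {K : ℕ} {n : Fin K → ℕ} {M : Fin K → Type*} [∀ a, TopologicalSpace (M a)]
    (φ : ∀ a, OpenPartialHomeomorph (M a) (Fin (n a) → ℝ)) (u : CalabiIndex n → ℝ) :
    (Fin (K - 1) → ℝ) × (∀ a, M a) :=
  (fun l => u (tIdx l), fun a => (φ a).symm (factorCoord u a))

/-- The index triples that are listed as carrying possibly nonzero components: `(λ, λ, μ)` with
`λ ≤ μ`, `(ī_a, j̄_a, λ)` with `λ ≥ a - 1`, and `(ī_a, j̄_a, k̄_a)`. -/
inductive IsListed {K : ℕ} {n : Fin K → ℕ} :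
    CalabiIndex n → CalabiIndex n → CalabiIndex n → Prop
  | ttt (l m : Fin (K - 1)) (h : l ≤ m) : IsListed (tIdx l) (tIdx l) (tIdx m)
  | vvt (a : Fin K) (i j : Fin (n a)) (l : Fin (K - 1)) (h : a.val ≤ l.val + 1) :
      IsListed (vIdx a i) (vIdx a j) (tIdx l)
  | vvv (a : Fin K) (i j k : Fin (n a)) : IsListed (vIdx a i) (vIdx a j) (vIdx a k)

/-- There are as many ambient coordinates as coordinates on the hypersurface plus one. -/
theorem nonempty_order {K : ℕ} (hK : 2 ≤ K) (n : Fin K → ℕ) :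
    Nonempty (Option (CalabiIndex n) ≃ Σ a : Fin K, Fin (n a + 1)) := by
  apply Fintype.card_eq.mp
  simp only [Fintype.card_option, Fintype.card_sum, Fintype.card_fin, Fintype.card_sigma,
    Finset.sum_add_distrib, Finset.sum_const, Finset.card_univ, smul_eq_mul, mul_one]
  omega

end

end AffineHypersurface

open AffineHypersurface

/-! A hyperbolic affine hypersphere centered at the origin is transversal to its position vector, so
it can be studied through the centroaffine Gauss equation `∂_i∂_j y = Γ^k_{ij} ∂_k y + G_{ij} y`,
which involves no affine normal. Three facts translate back to equiaffine geometry, with `D =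
det(∂_1 y, …, ∂_n y, y)`. By Țițeica's criterion, `y` is a hypersphere of mean curvature `L` exactly
when `|det G| = D² (-L)^{n+2}` (`affineNormal_of_hypersphere` with `metricRatio_mul_eq_one_iff`, and
conversely `hypersphere_of_det`). In that case the affine metric is `-G/L`, and the Fubini–Pick form
is `1/(2L)` times the covariant derivative of `G` (`fubiniPick_eq`).

For the Calabi composition, let `ε_{aλ}` be the coefficient of `t^λ` in the exponent of `e_a`. Then
`∂_λ` multiplies the `a`-th block of `x` by `ε_{aλ}`. The vectors `1, ε_1, …, ε_{K-1}` form an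
orthogonal basis of `ℝ^K` for the weights `n_a + 1` (`sum_eps`, `sum_eps_eps`, `eps_complete`).
Expanding second derivatives of `x` in this basis gives all its Gauss coefficients: `G` is block
diagonal, with entries `N_λ/f_K` and blocks `(n_a+1)/f_K · G^{(a)}`, where `N_λ` is the weighted
squared length of `ε_λ`. The weighted Gram matrix of the basis gives `D²`, and Țițeica's criterion
then yields both the hypersphere property and the constant `C` (`abs_det_calabiForm`).

The Fubini–Pick components reduce to the sums `∑_a (n_a+1) ε_{aλ} ε_{aμ} ε_{aν}`, to `ε_{aλ} g_{ī_a
j̄_a}`, and to multiples of the cubic forms of the factors. Which of them vanish is read off from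
the supports of the `ε_λ`. -/

namespace AffineHypersurface

open scoped Matrix

set_option linter.unusedSectionVars false

noncomputable section

/-! ### Calculus of partial derivatives, determinants and inverse matrices. -/

section PartialDerivatives

variable {ι κ : Type*} [Fintype ι] [DecidableEq ι] [Fintype κ] [DecidableEq κ]
variable {F : Type*} [NormedAddCommGroup F] [NormedSpace ℝ F] {u : ι → ℝ} {U : Set (ι → ℝ)}

theorem pd_congr (hU : IsOpen U) {f g : (ι → ℝ) → F} (h : Set.EqOn f g U) (hu : u ∈ U) (i : ι) :
    pd i f u = pd i g u := by
  have : f =ᶠ[nhds u] g := Filter.eventuallyEq_of_mem (hU.mem_nhds hu) h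
  rw [pd, pd, this.fderiv_eq]

theorem pd_const (i : ι) (c : F) : pd i (fun _ : ι → ℝ => c) u = 0 := by
  simp [pd]

theorem pd_apply {f : (ι → ℝ) → κ → ℝ} (hf : DifferentiableAt ℝ f u) (i : ι) (k : κ) :
    pd i f u k = pd i (fun v => f v k) u := by
  have := fderiv_pi (𝕜 := ℝ) (φ := fun k v => f v k) (x := u)
    (fun k => differentiableAt_pi.1 hf k)
  have h2 : fderiv ℝ f u = ContinuousLinearMap.pi fun k => fderiv ℝ (fun v => f v k) u := this
  simp [pd, h2]

theorem pd_add {f g : (ι → ℝ) → F} (hf : DifferentiableAt ℝ f u) (hg : DifferentiableAt ℝ g u)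
    (i : ι) : pd i (fun v => f v + g v) u = pd i f u + pd i g u := by
  simp [pd, fderiv_fun_add hf hg]

theorem pd_sum {α : Type*} {s : Finset α} {f : α → (ι → ℝ) → F}
    (hf : ∀ a ∈ s, DifferentiableAt ℝ (f a) u) (i : ι) :
    pd i (fun v => ∑ a ∈ s, f a v) u = ∑ a ∈ s, pd i (f a) u := by
  simp [pd, fderiv_fun_sum hf]

theorem pd_smul {c : (ι → ℝ) → ℝ} {f : (ι → ℝ) → F} (hc : DifferentiableAt ℝ c u)
    (hf : DifferentiableAt ℝ f u) (i : ι) :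
    pd i (fun v => c v • f v) u = pd i c u • f u + c u • pd i f u := by
  simp [pd, fderiv_fun_smul hc hf, add_comm]

theorem pd_const_smul (c : ℝ) {f : (ι → ℝ) → F} (hf : DifferentiableAt ℝ f u) (i : ι) :
    pd i (fun v => c • f v) u = c • pd i f u := by
  simp [pd, fderiv_fun_const_smul hf]

theorem pd_mul {c f : (ι → ℝ) → ℝ} (hc : DifferentiableAt ℝ c u)
    (hf : DifferentiableAt ℝ f u) (i : ι) :
    pd i (fun v => c v * f v) u = pd i c u * f u + c u * pd i f u :=
  pd_smul hc hf i

theorem pd_const_mul (c : ℝ) {f : (ι → ℝ) → ℝ} (hf : DifferentiableAt ℝ f u) (i : ι) :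
    pd i (fun v => c * f v) u = c * pd i f u :=
  pd_const_smul c hf i

theorem contDiffOn_pd (hU : IsOpen U) {f : (ι → ℝ) → F} (hf : ContDiffOn ℝ ∞ f U) (i : ι) :
    ContDiffOn ℝ ∞ (pd i f) U :=
  (hf.fderiv_of_isOpen hU (m := ∞) (by simp)).clm_apply contDiffOn_const

theorem differentiableAt_of_contDiffOn (hU : IsOpen U) {f : (ι → ℝ) → F} (hf : ContDiffOn ℝ ∞ f U)
    (hu : u ∈ U) : DifferentiableAt ℝ f u :=
  (hf.contDiffAt (hU.mem_nhds hu)).differentiableAt (by simp)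

theorem pd_comm (hU : IsOpen U) {f : (ι → ℝ) → F} (hf : ContDiffOn ℝ ∞ f U) (hu : u ∈ U)
    (i j : ι) : pd i (pd j f) u = pd j (pd i f) u := by
  have hs : IsSymmSndFDerivAt ℝ f u :=
    (hf.contDiffAt (hU.mem_nhds hu)).isSymmSndFDerivAt (by
      rw [minSmoothness_of_isRCLikeNormedField]; exact WithTop.coe_le_coe.2 le_top)
  have hd : DifferentiableAt ℝ (fderiv ℝ f) u :=
    differentiableAt_of_contDiffOn hU (hf.fderiv_of_isOpen hU (m := ∞) (by simp)) hu
  have key : ∀ a b : ι, pd a (pd b f) u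
      = fderiv ℝ (fderiv ℝ f) u (Pi.single a 1) (Pi.single b 1) := by
    intro a b
    have : fderiv ℝ (fun v => fderiv ℝ f v (Pi.single b 1)) u
        = (fderiv ℝ (fderiv ℝ f) u).flip (Pi.single b 1) := by
      rw [fderiv_clm_apply hd (differentiableAt_const _)]
      ext; simp
    change fderiv ℝ (fun v => fderiv ℝ f v (Pi.single b 1)) u (Pi.single a 1) = _
    rw [this]; rfl
  rw [key, key]
  exact hs.eq _ _

theorem contDiffOn_det {F : (ι → ℝ) → Matrix κ κ ℝ}
    (hF : ∀ p q, ContDiffOn ℝ ∞ (fun v => F v p q) U) :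
    ContDiffOn ℝ ∞ (fun v => (F v).det) U := by
  simp only [Matrix.det_apply']
  exact ContDiffOn.sum fun σ _ => contDiffOn_const.mul (contDiffOn_prod fun p _ => hF _ _)

/-- By Cramer's rule an entry of the inverse is a quotient of determinants, hence smooth. -/
theorem contDiffOn_inv {F : (ι → ℝ) → Matrix κ κ ℝ}
    (hF : ∀ p q, ContDiffOn ℝ ∞ (fun v => F v p q) U) (h0 : ∀ v ∈ U, (F v).det ≠ 0) (p q : κ) :
    ContDiffOn ℝ ∞ (fun v => (F v)⁻¹ p q) U := by
  have : ContDiffOn ℝ ∞ (fun v => ((F v).det)⁻¹ * ((F v).updateRow q (Pi.single p 1)).det) U := by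
    refine ((contDiffOn_det hF).inv h0).mul (contDiffOn_det fun a b => ?_)
    by_cases h : a = q
    · subst h; simpa using contDiffOn_const
    · simpa [Matrix.updateRow_ne h] using hF a b
  refine this.congr fun v _ => ?_
  simp [Matrix.inv_def, Matrix.adjugate_apply]

theorem pd_det {F : (ι → ℝ) → Matrix κ κ ℝ} (hF : ∀ p q, DifferentiableAt ℝ (fun v => F v p q) u)
    (i : ι) : pd i (fun v => (F v).det) u =
      ∑ p, ((F u).updateRow p fun q => pd i (fun v => F v p q) u).det := by
  let D : ContinuousMultilinearMap ℝ (fun _ : κ => κ → ℝ) ℝ :=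
    ⟨(Matrix.detRowAlternating (n := κ) (R := ℝ)).toMultilinearMap, by
      change Continuous fun m : Matrix κ κ ℝ => m.det
      exact continuous_id.matrix_det⟩
  have hd : ∀ p, DifferentiableAt ℝ (fun v => F v p) u := fun p =>
    differentiableAt_pi.2 fun q => hF p q
  have h := HasFDerivAt.multilinear_comp (f := D) (g := fun p v => F v p)
    (fun p => (hd p).hasFDerivAt)
  have h2 : HasFDerivAt (fun v => (F v).det) _ u := h
  rw [pd, h2.fderiv]
  simp only [sum_apply, ContinuousLinearMap.comp_apply]
  refine Finset.sum_congr rfl fun p _ => ?_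
  have h3 : (fun q => pd i (fun v => F v p q) u) = fderiv ℝ (fun v => F v p) u (Pi.single i 1) := by
    funext q
    exact (pd_apply (hd p) i q).symm
  rw [h3]
  rfl

/-- Jacobi's formula for a moving frame `F` with `∂_i F = Ω F`. -/
theorem pd_det_of_eq_mul {F : (ι → ℝ) → Matrix κ κ ℝ} {Ω : Matrix κ κ ℝ} {i : ι}
    (hF : ∀ p q, DifferentiableAt ℝ (fun v => F v p q) u)
    (h : ∀ p q, pd i (fun v => F v p q) u = ∑ r, Ω p r * F u r q) :
    pd i (fun v => (F v).det) u = (∑ p, Ω p p) * (F u).det := by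
  rw [pd_det hF, Finset.sum_mul]
  refine Finset.sum_congr rfl fun p _ => ?_
  have : (fun q => pd i (fun v => F v p q) u) = ∑ r, Ω p r • F u r := by
    funext q; simp [h]
  rw [this, Matrix.det_updateRow_sum, smul_eq_mul]

/-- The derivative of the determinant of an invertible matrix. -/
theorem pd_det_of_invertible {F : (ι → ℝ) → Matrix κ κ ℝ}
    (hF : ∀ p q, DifferentiableAt ℝ (fun v => F v p q) u) (h0 : (F u).det ≠ 0) (i : ι) :
    pd i (fun v => (F v).det) u =
      (∑ p, ∑ q, (F u)⁻¹ p q * pd i (fun v => F v q p) u) * (F u).det := by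
  have hu : IsUnit (F u).det := h0.isUnit
  let P : Matrix κ κ ℝ := Matrix.of fun p q => pd i (fun v => F v p q) u
  rw [pd_det_of_eq_mul (Ω := P * (F u)⁻¹) hF]
  · congr 1
    have := Matrix.trace_mul_comm P (F u)⁻¹
    simpa [Matrix.trace, Matrix.mul_apply, P] using this
  · intro p q
    have : (P * (F u)⁻¹ * F u) p q = P p q := by
      rw [Matrix.mul_assoc, Matrix.nonsing_inv_mul _ hu, Matrix.mul_one]
    rw [Matrix.mul_apply] at this
    exact this.symm

theorem pd_inv_mul {F G : (ι → ℝ) → Matrix κ κ ℝ} (hU : IsOpen U) (hu : u ∈ U)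
    (hF : ∀ p q, DifferentiableAt ℝ (fun v => F v p q) u)
    (hG : ∀ p q, DifferentiableAt ℝ (fun v => G v p q) u)
    (h : ∀ v ∈ U, F v * G v = 1) (i : ι) (p q : κ) :
    ∑ r, pd i (fun v => F v p r) u * G u r q = -∑ r, F u p r * pd i (fun v => G v r q) u := by
  have h1 : pd i (fun v => ∑ r, F v p r * G v r q) u = 0 := by
    rw [pd_congr hU (g := fun _ => (1 : Matrix κ κ ℝ) p q) (fun v hv => ?_) hu, pd_const]
    change _ = (1 : Matrix κ κ ℝ) p q
    rw [← h v hv, Matrix.mul_apply]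
  rw [pd_sum (f := fun r v => F v p r * G v r q) fun r _ => (hF p r).mul (hG r q)] at h1
  simp only [pd_mul (hF _ _) (hG _ _), Finset.sum_add_distrib] at h1
  linarith

/-- The logarithmic derivative does not see the sign; in this form no case distinction on the
orientation of a frame is needed. -/
theorem pd_abs {f : (ι → ℝ) → ℝ} (hf : DifferentiableAt ℝ f u) (h0 : f u ≠ 0) {i : ι} {c : ℝ}
    (h : pd i f u = c * f u) : pd i (fun v => |f v|) u = c * |f u| := by
  have := (hf.hasFDerivAt.abs h0).fderiv
  rw [pd, this]
  rw [pd] at h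
  simp only [smul_apply, h, smul_eq_mul]
  rw [mul_left_comm, sign_mul_self]

end PartialDerivatives

/-! ### The centroaffine Gauss equation, Codazzi equation and cubic form. -/

section Frames

variable {ι κ : Type*} [Fintype ι] [DecidableEq ι] [Fintype κ] [DecidableEq κ]
variable {e : Option ι ≃ κ} {y : (ι → ℝ) → κ → ℝ} {u : ι → ℝ} {U : Set (ι → ℝ)}

theorem frameMatrix_some (w : κ → ℝ) (i : ι) : frameMatrix e y u w (e (some i)) = pd i y u := by
  funext q; simp [frameMatrix]

theorem frameMatrix_none (w : κ → ℝ) : frameMatrix e y u w (e none) = w := by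
  funext q; simp [frameMatrix]

theorem sum_smul_frameMatrix (w : κ → ℝ) (c : κ → ℝ) :
    ∑ p, c p • frameMatrix e y u w p =
      ∑ i, c (e (some i)) • pd i y u + c (e none) • w := by
  rw [← Equiv.sum_comp e, Fintype.sum_option]
  simp only [frameMatrix_some, frameMatrix_none]
  rw [add_comm]

theorem frameMatrix_updateRow (w w' : κ → ℝ) :
    (frameMatrix e y u w).updateRow (e none) w' = frameMatrix e y u w' := by
  ext p q
  obtain ⟨o, rfl⟩ := e.surjective p
  cases o with
  | none => simp [frameMatrix]
  | some i => simp [frameMatrix]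

/-- Tangential terms repeat rows of the frame and drop out. Applied to the Gauss equation this makes
the second fundamental form a multiple of `G`. -/
theorem frameDet_combination (w : κ → ℝ) (c : ι → ℝ) (b : ℝ) :
    frameDet e y u (∑ i, c i • pd i y u + b • w) = b * frameDet e y u w := by
  have h := Matrix.det_updateRow_sum (frameMatrix e y u w) (e none)
    (fun p => (e.symm p).elim b c)
  rw [sum_smul_frameMatrix, frameMatrix_updateRow] at h
  simpa [frameDet] using h

theorem frameDet_smul (w : κ → ℝ) (b : ℝ) :
    frameDet e y u (b • w) = b * frameDet e y u w := by
  simpa using frameDet_combination (e := e) (y := y) (u := u) w 0 b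

theorem vecMul_frameMatrix_inv {w v : κ → ℝ} (h0 : frameDet e y u w ≠ 0) {c : ι → ℝ} {b : ℝ}
    (hv : v = ∑ i, c i • pd i y u + b • w) (o : Option ι) :
    Matrix.vecMul v (frameMatrix e y u w)⁻¹ (e o) = o.elim b c := by
  have h1 : v = Matrix.vecMul (fun p => (e.symm p).elim b c) (frameMatrix e y u w) := by
    rw [Matrix.vecMul_eq_sum, sum_smul_frameMatrix, hv]
    simp
  rw [h1, Matrix.vecMul_vecMul, Matrix.mul_nonsing_inv _ (Ne.isUnit h0), Matrix.vecMul_one]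
  simp

theorem eq_sum_frame {w : κ → ℝ} (h0 : frameDet e y u w ≠ 0) (v : κ → ℝ) :
    v = ∑ i, Matrix.vecMul v (frameMatrix e y u w)⁻¹ (e (some i)) • pd i y u +
      Matrix.vecMul v (frameMatrix e y u w)⁻¹ (e none) • w := by
  rw [← sum_smul_frameMatrix, ← Matrix.vecMul_eq_sum, Matrix.vecMul_vecMul,
    Matrix.nonsing_inv_mul _ (Ne.isUnit h0), Matrix.vecMul_one]

theorem frame_coeff_unique {w : κ → ℝ} (h0 : frameDet e y u w ≠ 0) {c c' : ι → ℝ} {b b' : ℝ}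
    (h : ∑ i, c i • pd i y u + b • w = ∑ i, c' i • pd i y u + b' • w) : c = c' ∧ b = b' := by
  have h1 := fun o => vecMul_frameMatrix_inv h0 (rfl : _ = ∑ i, c i • pd i y u + b • w) o
  have h2 := fun o => vecMul_frameMatrix_inv h0 h o
  refine ⟨funext fun i => ?_, ?_⟩
  · exact (h1 (some i)).symm.trans (h2 (some i))
  · exact (h1 none).symm.trans (h2 none)

theorem contDiffOn_frameMatrix (hU : IsOpen U) (hy : ContDiffOn ℝ ∞ y U)
    {w : (ι → ℝ) → κ → ℝ} (hw : ContDiffOn ℝ ∞ w U) (p q : κ) :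
    ContDiffOn ℝ ∞ (fun v => frameMatrix e y v (w v) p q) U := by
  obtain ⟨o, rfl⟩ := e.surjective p
  cases o with
  | none => simp only [frameMatrix_none]; exact (contDiffOn_pi.1 hw) q
  | some i =>
    simp only [frameMatrix_some]
    exact (contDiffOn_pi.1 (contDiffOn_pd hU hy i)) q

theorem contDiffOn_frameDet (hU : IsOpen U) (hy : ContDiffOn ℝ ∞ y U)
    {w : (ι → ℝ) → κ → ℝ} (hw : ContDiffOn ℝ ∞ w U) :
    ContDiffOn ℝ ∞ (fun v => frameDet e y v (w v)) U :=
  contDiffOn_det (contDiffOn_frameMatrix hU hy hw)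

/-- The Gauss equation `∂_i∂_j y = Γ^k_{ij} ∂_k y + G_{ij} y` of a hypersurface that is transversal
to its position vector. -/
structure CentroaffineGauss (e : Option ι ≃ κ) (y : (ι → ℝ) → κ → ℝ) (U : Set (ι → ℝ))
    (Γ : ι → ι → ι → (ι → ℝ) → ℝ) (G : (ι → ℝ) → Matrix ι ι ℝ) : Prop where
  isOpen : IsOpen U
  smooth : ContDiffOn ℝ ∞ y U
  det_ne : ∀ u ∈ U, frameDet e y u (y u) ≠ 0
  gauss : ∀ u ∈ U, ∀ i j,
    pd i (pd j y) u = ∑ k, Γ k i j u • pd k y u + G u i j • y u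

theorem exists_centroaffineGauss (hU : IsOpen U) (hy : ContDiffOn ℝ ∞ y U)
    (h0 : ∀ u ∈ U, frameDet e y u (y u) ≠ 0) : ∃ Γ G, CentroaffineGauss e y U Γ G :=
  ⟨fun k i j v => Matrix.vecMul (pd i (pd j y) v) (frameMatrix e y v (y v))⁻¹ (e (some k)),
    fun v => Matrix.of fun i j =>
      Matrix.vecMul (pd i (pd j y) v) (frameMatrix e y v (y v))⁻¹ (e none),
    hU, hy, h0, fun u hu _ _ => eq_sum_frame (h0 u hu) _⟩

namespace CentroaffineGauss

variable {Γ : ι → ι → ι → (ι → ℝ) → ℝ} {G : (ι → ℝ) → Matrix ι ι ℝ}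

theorem diffAt (h : CentroaffineGauss e y U Γ G) (hu : u ∈ U) {E : Type*} [NormedAddCommGroup E]
    [NormedSpace ℝ E] {f : (ι → ℝ) → E} (hf : ContDiffOn ℝ ∞ f U) : DifferentiableAt ℝ f u :=
  differentiableAt_of_contDiffOn h.isOpen hf hu

theorem contDiffOn_coord (h : CentroaffineGauss e y U Γ G) {w : (ι → ℝ) → κ → ℝ}
    (hw : ContDiffOn ℝ ∞ w U) (p : κ) :
    ContDiffOn ℝ ∞ (fun v => Matrix.vecMul (w v) (frameMatrix e y v (y v))⁻¹ p) U := by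
  simp only [Matrix.vecMul, dotProduct]
  exact ContDiffOn.sum fun q _ => (contDiffOn_pi.1 hw q).mul
    (contDiffOn_inv (contDiffOn_frameMatrix h.isOpen h.smooth h.smooth) h.det_ne q p)

theorem contDiffOn_conn (h : CentroaffineGauss e y U Γ G) (k i j : ι) :
    ContDiffOn ℝ ∞ (Γ k i j) U :=
  (h.contDiffOn_coord (contDiffOn_pd h.isOpen (contDiffOn_pd h.isOpen h.smooth j) i)
    (e (some k))).congr fun v hv =>
      (vecMul_frameMatrix_inv (h.det_ne v hv) (h.gauss v hv i j) (some k)).symm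

theorem contDiffOn_form (h : CentroaffineGauss e y U Γ G) (i j : ι) :
    ContDiffOn ℝ ∞ (fun v => G v i j) U :=
  (h.contDiffOn_coord (contDiffOn_pd h.isOpen (contDiffOn_pd h.isOpen h.smooth j) i)
    (e none)).congr fun v hv =>
      (vecMul_frameMatrix_inv (h.det_ne v hv) (h.gauss v hv i j) none).symm

theorem symm (h : CentroaffineGauss e y U Γ G) (hu : u ∈ U) (i j : ι) :
    (∀ k, Γ k i j u = Γ k j i u) ∧ G u i j = G u j i := by
  have h1 := pd_comm h.isOpen h.smooth hu i j
  rw [h.gauss u hu, h.gauss u hu] at h1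
  have := frame_coeff_unique (h.det_ne u hu) h1
  exact ⟨fun k => congrFun this.1 k, this.2⟩

/-- The covariant derivative `C_{ijk} = ∂_k G_{ij} - Γ^l_{ki} G_{lj} - Γ^l_{kj} G_{il}`. -/
def _root_.AffineHypersurface.cubicForm (Γ : ι → ι → ι → (ι → ℝ) → ℝ) (G : (ι → ℝ) → Matrix ι ι ℝ)
    (u : ι → ℝ) (i j k : ι) : ℝ :=
  pd k (fun v => G v i j) u - ∑ l, G u l j * Γ l k i u - ∑ l, G u i l * Γ l k j u

theorem cubicForm_swap (h : CentroaffineGauss e y U Γ G) (hu : u ∈ U) (i j k : ι) :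
    cubicForm Γ G u i j k = cubicForm Γ G u j i k := by
  have h1 : pd k (fun v => G v i j) u = pd k (fun v => G v j i) u :=
    pd_congr h.isOpen (fun v hv => (h.symm hv i j).2) hu k
  simp only [cubicForm, h1, fun l => (h.symm hu l j).2, fun l => (h.symm hu i l).2]
  ring

theorem codazzi (h : CentroaffineGauss e y U Γ G) (hu : u ∈ U) (i j k : ι) :
    pd k (fun v => G v i j) u + ∑ l, Γ l i j u * G u k l =
      pd i (fun v => G v k j) u + ∑ l, Γ l k j u * G u i l := by
  -- Third derivatives in the frame `(∂_m y, y)`. The term with `m = b` comes from differentiating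
  -- `y` in `G_{aj} y`. Only the coefficient of `y` is used below; the tangential one would give the
  -- curvature equation.
  have key : ∀ a b : ι, pd b (pd a (pd j y)) u =
      ∑ m, (pd b (Γ m a j) u + ∑ l, Γ l a j u * Γ m b l u + if m = b then G u a j else 0)
          • pd m y u
        + (pd b (fun v => G v a j) u + ∑ l, Γ l a j u * G u b l) • y u := by
    intro a b
    rw [pd_congr h.isOpen (g := fun v => ∑ k, Γ k a j v • pd k y v + G v a j • y v)
      (fun v hv => h.gauss v hv a j) hu b]
    have d1 : ∀ k ∈ Finset.univ, DifferentiableAt ℝ (fun v => Γ k a j v • pd k y v) u :=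
      fun k _ => (h.diffAt hu (h.contDiffOn_conn k a j)).smul (h.diffAt hu (contDiffOn_pd h.isOpen h.smooth k))
    rw [pd_add (f := fun v => ∑ k, Γ k a j v • pd k y v) (g := fun v => G v a j • y v)
      (DifferentiableAt.fun_sum d1) ((h.diffAt hu (h.contDiffOn_form a j)).smul (h.diffAt hu h.smooth)),
      pd_sum d1, pd_smul (h.diffAt hu (h.contDiffOn_form a j)) (h.diffAt hu h.smooth)]
    simp only [fun k => pd_smul (h.diffAt hu (h.contDiffOn_conn k a j))
      (h.diffAt hu (contDiffOn_pd h.isOpen h.smooth k)) b, h.gauss u hu, smul_add, Finset.sum_add_distrib,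
      add_smul, Finset.smul_sum, ite_smul, zero_smul, Finset.sum_ite_eq', Finset.mem_univ, if_true,
      Finset.sum_smul, smul_smul]
    rw [Finset.sum_comm (γ := ι)]
    abel
  have h1 := pd_comm h.isOpen (contDiffOn_pd h.isOpen h.smooth j) hu k i
  rw [key, key] at h1
  exact (frame_coeff_unique (h.det_ne u hu) h1).2

/-- The terms containing `Γ^l_{ik} G_{lj}` agree because `Γ` is symmetric, and the rest is the
Codazzi equation. Together with `cubicForm_swap` this generates total symmetry. -/
theorem cubicForm_rotate (h : CentroaffineGauss e y U Γ G) (hu : u ∈ U) (i j k : ι) :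
    cubicForm Γ G u i j k = cubicForm Γ G u k j i := by
  have h1 := h.codazzi hu i j k
  have e1 : ∀ l, Γ l k i u = Γ l i k u := fun l => (h.symm hu k i).1 l
  simp only [cubicForm, e1]
  simp only [mul_comm (Γ _ _ _ _)] at h1
  linarith

/-- `∂_k D = Γ^l_{kl} D` for `D = det (∂_1 y, …, ∂_n y, y)`. -/
theorem pd_frameDet (h : CentroaffineGauss e y U Γ G) (hu : u ∈ U) (k : ι) :
    pd k (fun v => frameDet e y v (y v)) u = (∑ l, Γ l k l u) * frameDet e y u (y u) := by
  have hF : ∀ p q, DifferentiableAt ℝ (fun v => frameMatrix e y v (y v) p q) u := fun p q =>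
    differentiableAt_of_contDiffOn h.isOpen
      (contDiffOn_frameMatrix h.isOpen h.smooth h.smooth p q) hu
  -- The connection matrix of the frame `(∂_i y, y)`. The row of `y` is `∂_k y`, so its diagonal
  -- entry is `0` and the trace consists of Christoffel symbols only.
  let Ω : Matrix κ κ ℝ := Matrix.of fun p r =>
    (e.symm p).elim ((e.symm r).elim 0 fun j => if j = k then 1 else 0)
      fun i => (e.symm r).elim (G u k i) fun j => Γ j k i u
  have h1 := pd_det_of_eq_mul (Ω := Ω) (i := k) hF (by
    intro p q
    have h2 := congrFun (sum_smul_frameMatrix (e := e) (y := y) (u := u) (y u) (Ω p)) q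
    simp only [Finset.sum_apply, Pi.smul_apply, smul_eq_mul] at h2
    rw [h2]
    obtain ⟨o, rfl⟩ := e.surjective p
    cases o with
    | none =>
      simp only [frameMatrix_none]
      rw [← pd_apply (h.diffAt hu h.smooth)]
      simp [Ω]
    | some i =>
      simp only [frameMatrix_some]
      rw [← pd_apply (h.diffAt hu (contDiffOn_pd h.isOpen h.smooth i)), h.gauss u hu]
      simp [Ω])
  rw [show (fun v => frameDet e y v (y v)) = fun v => (frameMatrix e y v (y v)).det from rfl, h1]
  congr 1
  rw [← Equiv.sum_comp e, Fintype.sum_option]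
  simp [Ω]

end CentroaffineGauss

end Frames

/-! ### Hyperspheres in terms of the centroaffine data: Țițeica's criterion and the Fubini–Pick
form. -/

section Hyperspheres

variable {ι κ : Type*} [Fintype ι] [DecidableEq ι] [Fintype κ] [DecidableEq κ]
variable {e : Option ι ≃ κ} {y : (ι → ℝ) → κ → ℝ} {u : ι → ℝ} {U : Set (ι → ℝ)}

theorem pd_inv {f : (ι → ℝ) → ℝ} (hf : DifferentiableAt ℝ f u) (h0 : f u ≠ 0) {i : ι} {c : ℝ}
    (h : pd i f u = c * f u) : pd i (fun v => (f v)⁻¹) u = -c * (f u)⁻¹ := by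
  have : fderiv ℝ (fun v => (f v)⁻¹) u = -(f u ^ 2)⁻¹ • fderiv ℝ f u :=
    ((hasDerivAt_inv h0).comp_hasFDerivAt u hf.hasFDerivAt).fderiv
  rw [pd, this]
  rw [pd] at h
  simp only [smul_apply, h, smul_eq_mul]
  field_simp

/-- The factor `H^{-1/(n+2)} |D|` between the affine metric and the centroaffine one. -/
def metricRatio (e : Option ι ≃ κ) (y : (ι → ℝ) → κ → ℝ) (u : ι → ℝ) : ℝ :=
  absDet e y y u ^ (-(1 / ((Fintype.card ι : ℝ) + 2))) * |frameDet e y u (y u)|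

/-- On a hypersurface with transversal position vector, the coefficients `W^k` of the tangential
part of the Laplacian of the position vector. -/
def laplacianTangent (Γ : ι → ι → ι → (ι → ℝ) → ℝ) (g : (ι → ℝ) → Matrix ι ι ℝ) (u : ι → ℝ)
    (k : ι) : ℝ :=
  (1 / √|(g u).det|) * ∑ i, pd i (fun v => √|(g v).det| * (g v)⁻¹ i k) u
    + ∑ i, ∑ j, (g u)⁻¹ i j * Γ k i j u

theorem sum_inv_mul_eq_card {G : Matrix ι ι ℝ} (h0 : G.det ≠ 0) (hG : ∀ i j, G i j = G j i)
    {m : ℝ} (hm : m ≠ 0) : ∑ i, ∑ j, (m • G)⁻¹ i j * G i j = Fintype.card ι / m := by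
  have h1 : (m • G)⁻¹ = m⁻¹ • G⁻¹ := by
    have := Matrix.inv_smul' G (Units.mk0 m hm) h0.isUnit
    simpa [Units.smul_def] using this
  have h2 : ∀ i, ∑ j, (m • G)⁻¹ i j * G i j = m⁻¹ := by
    intro i
    have h3 : (G⁻¹ * G) i i = 1 := by rw [Matrix.nonsing_inv_mul _ h0.isUnit]; simp
    rw [Matrix.mul_apply] at h3
    rw [h1]
    simp only [Matrix.smul_apply, smul_eq_mul, mul_assoc, ← Finset.mul_sum]
    rw [Finset.sum_congr rfl fun j _ => by rw [hG i j], h3, mul_one]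
  simp [h2, div_eq_mul_inv]

theorem contDiffOn_sqrt_abs_det {g : (ι → ℝ) → Matrix ι ι ℝ}
    (hg : ∀ i j, ContDiffOn ℝ ∞ (fun v => g v i j) U) (h0 : ∀ v ∈ U, (g v).det ≠ 0) :
    ContDiffOn ℝ ∞ (fun v => √|(g v).det|) U :=
  ((contDiffOn_det hg).abs h0).sqrt fun v hv => abs_ne_zero.2 (h0 v hv)

namespace CentroaffineGauss

variable {Γ : ι → ι → ι → (ι → ℝ) → ℝ} {G : (ι → ℝ) → Matrix ι ι ℝ}

theorem secondForm_eq (h : CentroaffineGauss e y U Γ G) (hu : u ∈ U) :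
    secondForm e y y u = |frameDet e y u (y u)| • G u := by
  ext i j
  simp only [secondForm, Matrix.of_apply, Matrix.smul_apply, smul_eq_mul]
  rw [h.gauss u hu, frameDet_combination, mul_left_comm, mul_comm |_|]
  congr 1
  rcases lt_or_gt_of_ne (h.det_ne u hu) with hD | hD
  · rw [Real.sign_of_neg hD, abs_of_neg hD]; ring
  · rw [Real.sign_of_pos hD, abs_of_pos hD]; ring

theorem absDet_eq (h : CentroaffineGauss e y U Γ G) (hu : u ∈ U) :
    absDet e y y u = |frameDet e y u (y u)| ^ Fintype.card ι * |(G u).det| := by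
  rw [absDet, h.secondForm_eq hu, Matrix.det_smul, abs_mul, abs_pow, abs_abs]

theorem affineMetric_eq (h : CentroaffineGauss e y U Γ G) (hu : u ∈ U) :
    affineMetric e y y u = metricRatio e y u • G u := by
  rw [affineMetric, h.secondForm_eq hu, smul_smul, metricRatio]

theorem det_form_ne_zero_iff (h : CentroaffineGauss e y U Γ G) (hu : u ∈ U) :
    (secondForm e y y u).det ≠ 0 ↔ (G u).det ≠ 0 := by
  rw [h.secondForm_eq hu, Matrix.det_smul]
  have := h.det_ne u hu
  simp [this]

theorem absDet_pos (h : CentroaffineGauss e y U Γ G) (h0 : ∀ v ∈ U, (G v).det ≠ 0) (hu : u ∈ U) :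
    0 < absDet e y y u := by
  rw [h.absDet_eq hu]
  have := h.det_ne u hu
  have := h0 u hu
  positivity

theorem metricRatio_pos (h : CentroaffineGauss e y U Γ G) (h0 : ∀ v ∈ U, (G v).det ≠ 0)
    (hu : u ∈ U) : 0 < metricRatio e y u :=
  mul_pos (Real.rpow_pos_of_pos (h.absDet_pos h0 hu) _) (abs_pos.2 (h.det_ne u hu))

theorem contDiffOn_abs_frameDet (h : CentroaffineGauss e y U Γ G) :
    ContDiffOn ℝ ∞ (fun v => |frameDet e y v (y v)|) U :=
  (contDiffOn_frameDet h.isOpen h.smooth h.smooth).abs h.det_ne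

theorem contDiffOn_metricRatio (h : CentroaffineGauss e y U Γ G)
    (h0 : ∀ v ∈ U, (G v).det ≠ 0) : ContDiffOn ℝ ∞ (metricRatio e y) U := by
  have h1 : ContDiffOn ℝ ∞ (absDet e y y) U :=
    ((h.contDiffOn_abs_frameDet.pow _).mul ((contDiffOn_det h.contDiffOn_form).abs h0)).congr
      fun v hv => h.absDet_eq hv
  exact (h1.rpow_const_of_ne fun v hv => (h.absDet_pos h0 hv).ne').mul h.contDiffOn_abs_frameDet

/-- Țițeica's criterion: the ratio of the metrics expressed by determinants. -/
theorem metricRatio_mul_eq_one_iff (h : CentroaffineGauss e y U Γ G)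
    (h0 : ∀ v ∈ U, (G v).det ≠ 0) (hu : u ∈ U) {a : ℝ} (ha : 0 < a) :
    metricRatio e y u * a = 1 ↔
      |(G u).det| = frameDet e y u (y u) ^ 2 * a ^ (Fintype.card ι + 2) := by
  have hD := abs_pos.2 (h.det_ne u hu)
  have hH := h.absDet_pos h0 hu
  have hn : (0 : ℝ) < (Fintype.card ι : ℝ) + 2 := by positivity
  have h1 : metricRatio e y u * a = 1 ↔
      absDet e y y u ^ (1 / ((Fintype.card ι : ℝ) + 2)) = |frameDet e y u (y u)| * a := by
    rw [metricRatio, Real.rpow_neg hH.le, mul_assoc, inv_mul_eq_one₀ (Real.rpow_pos_of_pos hH _).ne']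
  have h2 : absDet e y y u ^ (1 / ((Fintype.card ι : ℝ) + 2)) = |frameDet e y u (y u)| * a ↔
      absDet e y y u = (|frameDet e y u (y u)| * a) ^ (Fintype.card ι + 2) := by
    rw [one_div, Real.rpow_inv_eq hH.le (by positivity) hn.ne']
    rw [← Real.rpow_natCast]
    push_cast
    rfl
  rw [h1, h2, h.absDet_eq hu, mul_pow, pow_add, mul_assoc, sq_abs]
  exact mul_right_inj' (pow_ne_zero _ hD.ne')

/-- The product rule and the Gauss equation. Transversally only the trace of `G` with respect to `g`
appears; for `g` proportional to `G` it is `n` divided by the ratio. -/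
theorem laplacian_eq (h : CentroaffineGauss e y U Γ G) {g : (ι → ℝ) → Matrix ι ι ℝ}
    (hg : ∀ i j, ContDiffOn ℝ ∞ (fun v => g v i j) U) (h0 : ∀ v ∈ U, (g v).det ≠ 0) (hu : u ∈ U) :
    laplacian g y u = ∑ k, laplacianTangent Γ g u k • pd k y u
      + (∑ i, ∑ j, (g u)⁻¹ i j * G u i j) • y u := by
  have hs := contDiffOn_sqrt_abs_det hg h0
  have hs0 : √|(g u).det| ≠ 0 := (Real.sqrt_pos.2 (abs_pos.2 (h0 u hu))).ne'
  have hterm : ∀ i j, pd i (fun v => (√|(g v).det| * (g v)⁻¹ i j) • pd j y v) u =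
      pd i (fun v => √|(g v).det| * (g v)⁻¹ i j) u • pd j y u +
        (√|(g u).det| * (g u)⁻¹ i j) • (∑ k, Γ k i j u • pd k y u + G u i j • y u) := by
    intro i j
    rw [pd_smul (h.diffAt hu (hs.mul (contDiffOn_inv hg h0 i j)))
      (h.diffAt hu (contDiffOn_pd h.isOpen h.smooth j)), h.gauss u hu]
  rw [laplacian]
  simp only [hterm, laplacianTangent, Finset.sum_add_distrib, add_smul, smul_add, Finset.smul_sum,
    Finset.sum_smul, Finset.mul_sum, smul_smul]
  rw [← add_assoc]
  congr 2
  · exact Finset.sum_comm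
  · refine ((Finset.sum_congr rfl fun i _ => Finset.sum_comm).trans Finset.sum_comm).trans ?_
    refine Finset.sum_congr rfl fun k _ => Finset.sum_congr rfl fun i _ =>
      Finset.sum_congr rfl fun j _ => ?_
    congr 1
    field_simp
  · funext i
    refine Finset.sum_congr rfl fun j _ => ?_
    congr 1
    field_simp

theorem contDiffOn_affineMetric (h : CentroaffineGauss e y U Γ G)
    (h0 : ∀ v ∈ U, (G v).det ≠ 0) (i j : ι) :
    ContDiffOn ℝ ∞ (fun v => affineMetric e y y v i j) U :=
  ((h.contDiffOn_metricRatio h0).mul (h.contDiffOn_form i j)).congr fun v hv => by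
    simp [h.affineMetric_eq hv]

theorem affineNormal_eq [Nonempty ι] (h : CentroaffineGauss e y U Γ G)
    (h0 : ∀ v ∈ U, (G v).det ≠ 0) (hu : u ∈ U) :
    affineNormal e y y u =
      ∑ k, ((1 / (Fintype.card ι : ℝ)) * laplacianTangent Γ (affineMetric e y y) u k) • pd k y u
        + (metricRatio e y u)⁻¹ • y u := by
  have hn : (Fintype.card ι : ℝ) ≠ 0 := by simp
  have hdet : ∀ v ∈ U, (affineMetric e y y v).det ≠ 0 := fun v hv => by
    rw [h.affineMetric_eq hv, Matrix.det_smul]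
    exact mul_ne_zero (pow_ne_zero _ (h.metricRatio_pos h0 hv).ne') (h0 v hv)
  rw [affineNormal, h.laplacian_eq (h.contDiffOn_affineMetric h0) hdet hu]
  rw [smul_add, Finset.smul_sum, smul_smul, h.affineMetric_eq hu,
    sum_inv_mul_eq_card (h0 u hu) (fun i j => (h.symm hu i j).2) (h.metricRatio_pos h0 hu).ne']
  simp only [smul_smul]
  congr 2
  field_simp

/-- The affine normal of a hyperbolic affine hypersphere centered at the origin is `-L y`, and the
affine metric is `-1/L` times the centroaffine one. -/
theorem affineNormal_of_hypersphere [Nonempty ι] (h : CentroaffineGauss e y U Γ G) {L : ℝ}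
    (hy : IsHyperbolicHypersphereOn e y U L) (hu : u ∈ U) :
    affineNormal e y y u = (-L) • y u ∧ metricRatio e y u * (-L) = 1 := by
  have h0 : ∀ v ∈ U, (G v).det ≠ 0 := fun v hv =>
    (h.det_form_ne_zero_iff hv).1 (hy.nondegenerate v hv)
  have h1 : ∀ v ∈ U, affineNormal e y y v = (metricRatio e y v)⁻¹ • y v := by
    intro v hv
    obtain ⟨s, hs⟩ := hy.center v hv
    have hξ := h.affineNormal_eq h0 hv
    -- If `s` were `0`, the center condition would give `y = 0`, contrary to transversality.
    have hs' : s ≠ 0 := by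
      rintro rfl
      apply h.det_ne v hv
      have : y v = 0 := by simpa using hs
      have h2 := frameDet_smul (e := e) (y := y) (u := v) (y v) 0
      rw [zero_smul, zero_mul] at h2
      rw [this]; exact h2
    -- The vanishing of `y + s ξ`, read in the frame: its tangential part `s W / n` must be zero.
    have h3 := frame_coeff_unique (e := e) (h.det_ne v hv)
      (c := fun k => s * ((1 / (Fintype.card ι : ℝ)) *
        laplacianTangent Γ (affineMetric e y y) v k))
      (b := 1 + s * (metricRatio e y v)⁻¹) (c' := 0) (b' := 0) (by
        simp only [mul_smul, add_smul, one_smul, Pi.zero_apply, zero_smul, Finset.sum_const_zero,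
          add_zero]
        rw [← hs, hξ, smul_add, Finset.smul_sum]
        simp only [mul_smul]
        abel)
    have h4 : ∀ k, (1 / (Fintype.card ι : ℝ)) *
        laplacianTangent Γ (affineMetric e y y) v k = 0 := fun k => by
      have := congrFun h3.1 k
      simpa [hs'] using this
    rw [hξ]
    simp only [h4, zero_smul, Finset.sum_const_zero, zero_add]
  have hm := h.metricRatio_pos h0 hu
  have h2 : (metricRatio e y u)⁻¹ = -L := by
    obtain ⟨i⟩ := ‹Nonempty ι›
    have h3 := hy.shape u hu i
    rw [pd_congr h.isOpen (g := fun v => (metricRatio e y v)⁻¹ • y v) h1 hu,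
      pd_smul (c := fun v => (metricRatio e y v)⁻¹) (h.diffAt hu ((h.contDiffOn_metricRatio h0).inv
        fun v hv => (h.metricRatio_pos h0 hv).ne')) (h.diffAt hu h.smooth)] at h3
    -- Now `ξ = m⁻¹ y` with `m` the metric ratio; comparing the coefficients of `∂_i y` in the shape
    -- equation gives `m⁻¹ = -L`.
    have h4 := frame_coeff_unique (e := e) (h.det_ne u hu)
      (c := Pi.single i (metricRatio e y u)⁻¹) (b := pd i (fun v => (metricRatio e y v)⁻¹) u)
      (c' := Pi.single i (-L)) (b' := 0) (by
        rw [Finset.sum_eq_single i, Finset.sum_eq_single i]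
        · simp only [Pi.single_eq_same, zero_smul, add_zero, neg_smul]
          rw [← h3, add_comm]
        all_goals simp +contextual)
    simpa using congrFun h4.1 i
  refine ⟨by rw [h1 u hu, h2], ?_⟩
  rw [← h2, mul_inv_cancel₀ hm.ne']

/-- Transversality follows from nondegeneracy: where `D = 0`, the sign factor in `secondForm` is
`Real.sign 0 = 0`, so the whole form would vanish. A zero matrix is singular only for a nonempty
index type. -/
theorem exists_of_hypersphere [Nonempty ι] (hU : IsOpen U) {L : ℝ}
    (hy : IsHyperbolicHypersphereOn e y U L) : ∃ Γ G, CentroaffineGauss e y U Γ G := by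
  refine exists_centroaffineGauss hU hy.smooth fun v hv h0 => hy.nondegenerate v hv ?_
  have : secondForm e y y v = 0 := by
    ext i j; simp [secondForm, h0]
  rw [this, Matrix.det_zero]

theorem laplacianTangent_eq_zero (h : CentroaffineGauss e y U Γ G) {a : ℝ} (ha : 0 < a)
    (hG : ∀ v ∈ U, |(G v).det| = frameDet e y v (y v) ^ 2 * a ^ (Fintype.card ι + 2))
    (hg : ∀ v ∈ U, affineMetric e y y v = a⁻¹ • G v) (hu : u ∈ U) (k : ι) :
    laplacianTangent Γ (affineMetric e y y) u k = 0 := by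
  have h0 : ∀ v ∈ U, (G v).det ≠ 0 := fun v hv => by
    rw [← abs_pos, hG v hv]; have := h.det_ne v hv; positivity
  have hinv : ∀ v ∈ U, (affineMetric e y y v)⁻¹ = a • (G v)⁻¹ := fun v hv => by
    have := Matrix.inv_smul' (G v) (Units.mk0 a⁻¹ (inv_ne_zero ha.ne')) (h0 v hv).isUnit
    rw [hg v hv]
    simpa [Units.smul_def] using this
  -- By the determinant condition the metric volume is a constant multiple of `|D|`, which is
  -- parallel for `Γ`.
  have hsqrt : ∀ v ∈ U, √|(affineMetric e y y v).det| = a * |frameDet e y v (y v)| := by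
    intro v hv
    rw [hg v hv, Matrix.det_smul, abs_mul, hG v hv, abs_of_pos (by positivity)]
    rw [show a⁻¹ ^ Fintype.card ι * (frameDet e y v (y v) ^ 2 * a ^ (Fintype.card ι + 2)) =
      (a * |frameDet e y v (y v)|) ^ 2 by
        rw [mul_pow, sq_abs, pow_add, inv_pow]; field_simp]
    rw [Real.sqrt_sq (by positivity)]
  have hD := h.det_ne u hu
  have hDabs := h.contDiffOn_abs_frameDet
  have hpdD : ∀ i, pd i (fun v => |frameDet e y v (y v)|) u =
      (∑ l, Γ l i l u) * |frameDet e y u (y u)| := fun i =>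
    pd_abs (h.diffAt hu (contDiffOn_frameDet h.isOpen h.smooth h.smooth)) hD
      (h.pd_frameDet hu i)
  have hGi := contDiffOn_inv h.contDiffOn_form h0
  have hterm : ∀ i, pd i (fun v => √|(affineMetric e y y v).det| *
      (affineMetric e y y v)⁻¹ i k) u = a ^ 2 * |frameDet e y u (y u)| *
        ((∑ l, Γ l i l u) * (G u)⁻¹ i k + pd i (fun v => (G v)⁻¹ i k) u) := by
    intro i
    rw [pd_congr h.isOpen (g := fun v => a ^ 2 * (|frameDet e y v (y v)| * (G v)⁻¹ i k))
      (fun v hv => by simp only [hsqrt v hv, hinv v hv, Matrix.smul_apply, smul_eq_mul]; ring) hu,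
      pd_const_mul _ (h.diffAt hu (hDabs.mul (hGi i k))),
      pd_mul (h.diffAt hu hDabs) (h.diffAt hu (hGi i k)), hpdD]
    ring
  rw [laplacianTangent, hsqrt u hu, hinv u hu]
  simp only [hterm, Matrix.smul_apply, smul_eq_mul, ← Finset.mul_sum, mul_assoc]
  have habs := abs_pos.2 hD
  -- derivative of the inverse
  have hGd : ∀ i j, DifferentiableAt ℝ (fun v => G v i j) u := fun i j =>
    h.diffAt hu (h.contDiffOn_form i j)
  have hinvd : ∀ i, pd i (fun v => (G v)⁻¹ i k) u =
      -∑ q, ∑ r, (G u)⁻¹ i r * pd i (fun v => G v r q) u * (G u)⁻¹ q k := by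
    intro i
    have h1 := fun q => pd_inv_mul h.isOpen hu (fun p q => h.diffAt hu (hGi p q)) hGd
      (fun v hv => Matrix.nonsing_inv_mul _ (h0 v hv).isUnit) i i q
    have h2 : ∑ q, (∑ r, pd i (fun v => (G v)⁻¹ i r) u * G u r q) * (G u)⁻¹ q k =
        pd i (fun v => (G v)⁻¹ i k) u := by
      simp only [Finset.sum_mul, mul_assoc]
      rw [Finset.sum_comm]
      simp only [← Finset.mul_sum]
      have h3 : ∀ r, ∑ q, G u r q * (G u)⁻¹ q k = if r = k then 1 else 0 := fun r => by
        rw [← Matrix.mul_apply, Matrix.mul_nonsing_inv _ (h0 u hu).isUnit, Matrix.one_apply]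
      simp [h3]
    rw [← h2]
    simp only [h1, Finset.sum_mul, neg_mul, Finset.sum_neg_distrib]
  -- the trace of the cubic form vanishes
  have htr : ∀ b, ∑ p, ∑ q, (G u)⁻¹ p q * pd b (fun v => G v q p) u = 2 * ∑ l, Γ l b l u := by
    intro b
    have h1 := pd_det_of_invertible hGd (h0 u hu) b
    have h2 := pd_abs (h.diffAt hu (contDiffOn_det h.contDiffOn_form)) (h0 u hu) h1
    rw [pd_congr h.isOpen (g := fun v => a ^ (Fintype.card ι + 2) *
      (frameDet e y v (y v) * frameDet e y v (y v)))
      (fun v hv => by simp only [hG v hv]; ring) hu] at h2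
    have hDd := h.diffAt hu (contDiffOn_frameDet (e := e) h.isOpen h.smooth h.smooth)
    rw [pd_const_mul (f := fun v => frameDet e y v (y v) * frameDet e y v (y v)) _ (hDd.mul hDd), pd_mul hDd hDd, h.pd_frameDet hu, hG u hu] at h2
    have h3 : (0 : ℝ) < frameDet e y u (y u) ^ 2 * a ^ (Fintype.card ι + 2) := by positivity
    apply mul_right_cancel₀ h3.ne'
    rw [← h2]; ring
  have hGsymm : ∀ i j, G u i j = G u j i := fun i j => (h.symm hu i j).2
  have hIsymm : ∀ i j, (G u)⁻¹ i j = (G u)⁻¹ j i := fun i j => by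
    have : (G u)ᵀ = G u := by ext i j; exact hGsymm j i
    conv_lhs => rw [← this, ← Matrix.transpose_nonsing_inv]
    rfl
  have hI1 : ∀ r s, ∑ q, (G u)⁻¹ r q * G u q s = if r = s then 1 else 0 := fun r s => by
    rw [← Matrix.mul_apply, Matrix.nonsing_inv_mul _ (h0 u hu).isUnit, Matrix.one_apply]
  -- Codazzi, contracted with the inverse
  have hcod : ∀ q, ∑ i, ∑ r, (G u)⁻¹ i r * pd i (fun v => G v r q) u =
      ∑ l, Γ l q l u + ∑ i, ∑ r, (G u)⁻¹ i r * ∑ l, Γ l i r u * G u q l := by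
    intro q
    have h1 : ∀ i r, (G u)⁻¹ i r * pd i (fun v => G v r q) u =
        (G u)⁻¹ i r * pd q (fun v => G v r i) u + (G u)⁻¹ i r * ∑ l, Γ l i r u * G u q l
          - (G u)⁻¹ i r * ∑ l, Γ l q r u * G u i l := by
      intro i r
      have h2 := h.codazzi hu q r i
      have h3 : pd i (fun v => G v r q) u = pd i (fun v => G v q r) u :=
        pd_congr h.isOpen (fun v hv => (h.symm hv r q).2) hu i
      have h4 : pd q (fun v => G v r i) u = pd q (fun v => G v i r) u :=
        pd_congr h.isOpen (fun v hv => (h.symm hv r i).2) hu q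
      rw [h3, h4]
      linear_combination (G u)⁻¹ i r * h2
    simp only [h1, Finset.sum_add_distrib, Finset.sum_sub_distrib, htr]
    have h5 : ∑ i, ∑ r, (G u)⁻¹ i r * ∑ l, Γ l q r u * G u i l = ∑ l, Γ l q l u := by
      rw [Finset.sum_comm]
      refine Finset.sum_congr rfl fun r _ => ?_
      simp only [Finset.mul_sum]
      rw [Finset.sum_comm]
      have : ∀ l, ∑ i, (G u)⁻¹ i r * (Γ l q r u * G u i l) =
          Γ l q r u * ∑ i, (G u)⁻¹ r i * G u i l := fun l => by
        rw [Finset.mul_sum]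
        exact Finset.sum_congr rfl fun i _ => by rw [hIsymm i r]; ring
      simp [this, hI1]
    rw [h5]; ring
  -- The divergence of `G⁻¹`, from the derivative of the inverse and the contracted Codazzi
  -- equation. Its two terms cancel the contribution of the volume and that of `Γ` in
  -- `laplacianTangent`.
  have hfin : ∑ i, pd i (fun v => (G v)⁻¹ i k) u =
      -(∑ q, (∑ l, Γ l q l u) * (G u)⁻¹ q k) - ∑ i, ∑ j, (G u)⁻¹ i j * Γ k i j u := by
    simp only [hinvd, Finset.sum_neg_distrib]
    rw [Finset.sum_comm]
    simp only [← Finset.sum_mul, hcod, add_mul, Finset.sum_add_distrib]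
    have h6 : ∑ q, (∑ i, ∑ r, (G u)⁻¹ i r * ∑ l, Γ l i r u * G u q l) * (G u)⁻¹ q k =
        ∑ i, ∑ j, (G u)⁻¹ i j * Γ k i j u := by
      simp only [Finset.sum_mul]
      rw [Finset.sum_comm]
      refine Finset.sum_congr rfl fun i _ => ?_
      rw [Finset.sum_comm]
      refine Finset.sum_congr rfl fun r _ => ?_
      have : ∀ q, (G u)⁻¹ i r * (∑ l, Γ l i r u * G u q l) * (G u)⁻¹ q k =
          ∑ l, (G u)⁻¹ i r * Γ l i r u * ((G u)⁻¹ k q * G u q l) := fun q => by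
        rw [Finset.mul_sum, Finset.sum_mul]
        exact Finset.sum_congr rfl fun l _ => by rw [hIsymm q k]; ring
      simp only [this]
      rw [Finset.sum_comm]
      simp only [← Finset.mul_sum, hI1]
      simp
    rw [h6]; ring
  rw [Finset.sum_add_distrib, hfin]
  field_simp
  ring

/-- The converse of Țițeica's criterion. -/
theorem hypersphere_of_det [Nonempty ι] (h : CentroaffineGauss e y U Γ G) {L : ℝ} (hL : L < 0)
    (hG : ∀ v ∈ U, |(G v).det| = frameDet e y v (y v) ^ 2 * (-L) ^ (Fintype.card ι + 2)) :
    IsHyperbolicHypersphereOn e y U L := by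
  have ha : 0 < -L := neg_pos.2 hL
  have h0 : ∀ v ∈ U, (G v).det ≠ 0 := fun v hv => by
    rw [← abs_pos, hG v hv]; have := h.det_ne v hv; positivity
  have hm : ∀ v ∈ U, metricRatio e y v = (-L)⁻¹ := fun v hv =>
    eq_inv_of_mul_eq_one_left ((h.metricRatio_mul_eq_one_iff h0 hv ha).2 (hG v hv))
  have hg : ∀ v ∈ U, affineMetric e y y v = (-L)⁻¹ • G v := fun v hv => by
    rw [h.affineMetric_eq hv, hm v hv]
  have hξ : ∀ v ∈ U, affineNormal e y y v = (-L) • y v := fun v hv => by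
    rw [h.affineNormal_eq h0 hv, hm v hv]
    simp [h.laplacianTangent_eq_zero ha hG hg hv]
  refine ⟨hL, h.smooth, fun v hv => (h.det_form_ne_zero_iff hv).2 (h0 v hv), fun v hv i => ?_,
    fun v hv => ⟨L⁻¹, ?_⟩⟩
  · rw [pd_congr h.isOpen (g := fun v => (-L) • y v) hξ hv,
      pd_const_smul _ (h.diffAt hv h.smooth), neg_smul]
  · rw [hξ v hv, smul_smul, mul_neg, inv_mul_cancel₀ hL.ne]
    simp

theorem fubiniPick_eq [Nonempty ι] (h : CentroaffineGauss e y U Γ G) {L : ℝ}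
    (hy : IsHyperbolicHypersphereOn e y U L) (hu : u ∈ U) (i j k : ι) :
    fubiniPick e y y u i j k = 1 / (2 * L) * cubicForm Γ G u i j k := by
  have hD := h.det_ne u hu
  have hDd := h.diffAt hu (contDiffOn_frameDet (e := e) h.isOpen h.smooth h.smooth)
  have hDa := h.diffAt hu h.contDiffOn_abs_frameDet
  have hpdD : ∀ i, pd i (fun v => |frameDet e y v (y v)|) u =
      (∑ l, Γ l i l u) * |frameDet e y u (y u)| := fun i => pd_abs hDd hD (h.pd_frameDet hu i)
  -- The normal is `-L y`, and the metric ratio times `-L` is `1`, which eliminates the power of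
  -- `H`.
  have hN : ∀ v ∈ U, unimodularNormal e y y v = |frameDet e y v (y v)|⁻¹ • y v := by
    intro v hv
    obtain ⟨h1, h2⟩ := h.affineNormal_of_hypersphere hy hv
    rw [unimodularNormal, h1, smul_smul]
    congr 1
    rw [metricRatio] at h2
    refine eq_inv_of_mul_eq_one_left ?_
    linear_combination h2
  have hdet : frameDet e y u (unimodularNormal e y y u) ≠ 0 := by
    rw [hN u hu, frameDet_smul]
    exact mul_ne_zero (inv_ne_zero (abs_ne_zero.2 hD)) hD
  have hy' : y u = |frameDet e y u (y u)| • unimodularNormal e y y u := by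
    rw [hN u hu, smul_smul, mul_inv_cancel₀ (abs_ne_zero.2 hD), one_smul]
  have hconn : ∀ l a b, connCoeff e y y u l a b = Γ l a b u := by
    intro l a b
    have h1 := h.gauss u hu a b
    rw [hy', smul_smul] at h1
    exact vecMul_frameMatrix_inv hdet h1 (some l)
  have hnorm : normalConn e y y u k = -∑ l, Γ l k l u := by
    have h1 : pd k (unimodularNormal e y y) u =
        ∑ l, (Pi.single k |frameDet e y u (y u)|⁻¹ : ι → ℝ) l • pd l y u +
          (-∑ l, Γ l k l u) • unimodularNormal e y y u := by
      rw [pd_congr h.isOpen (g := fun v => |frameDet e y v (y v)|⁻¹ • y v) hN hu,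
        pd_smul (hDa.fun_inv (abs_ne_zero.2 hD)) (h.diffAt hu h.smooth),
        pd_inv hDa (abs_ne_zero.2 hD) (hpdD k), hN u hu, smul_smul, add_comm]
      congr 1
      rw [Finset.sum_eq_single k]
      · simp
      all_goals simp +contextual
    exact vecMul_frameMatrix_inv hdet h1 none
  have hsec : pd k (fun v => secondForm e y y v i j) u =
      (∑ l, Γ l k l u) * |frameDet e y u (y u)| * G u i j +
        |frameDet e y u (y u)| * pd k (fun v => G v i j) u := by
    rw [pd_congr h.isOpen (g := fun v => |frameDet e y v (y v)| * G v i j)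
      (fun v hv => by simp [h.secondForm_eq hv]) hu,
      pd_mul hDa (h.diffAt hu (h.contDiffOn_form i j)), hpdD]
  -- The normal connection is minus the logarithmic derivative of `|D|`, so it cancels the
  -- derivative of the factor `|D|` in `h_{ij} = |D| G_{ij}`.
  have h3 : thirdForm e y y u i j k = |frameDet e y u (y u)| * cubicForm Γ G u i j k := by
    rw [thirdForm, hsec, hnorm, h.secondForm_eq hu]
    simp only [hconn, Matrix.smul_apply, smul_eq_mul, mul_assoc, ← Finset.mul_sum, cubicForm]
    ring
  have h4 := (h.affineNormal_of_hypersphere hy hu).2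
  have hL := hy.neg.ne
  rw [fubiniPick, h3]
  rw [metricRatio] at h4
  field_simp
  linear_combination cubicForm Γ G u i j k * h4

end CentroaffineGauss

end Hyperspheres

/-! ### Linear algebra of the exponents: the weighted orthogonal basis `1, ε_1, …, ε_{K-1}`. -/

section Weights

variable {K : ℕ} (n : Fin K → ℕ)

/-- The coefficient of `t^λ` in the exponent of `e_a`. -/
def calabiEps (a : Fin K) (l : Fin (K - 1)) : ℝ :=
  if l.val + 1 = a.val then -(1 / ((n a : ℝ) + 1))
  else if a.val ≤ l.val then 1 / calabiF n (l.val + 1) else 0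

/-- The factor that is attached by the parameter `t^λ` to the previous ones. -/
def attached (l : Fin (K - 1)) : Fin K := ⟨l.val + 1, by omega⟩

/-- The squared length of the `λ`-th vector of coefficients for the weights `n_a + 1`. -/
def calabiNorm (l : Fin (K - 1)) : ℝ :=
  1 / calabiF n (l.val + 1) + 1 / ((n (attached l) : ℝ) + 1)

theorem calabiE_eq (t : Fin (K - 1) → ℝ) (a : Fin K) :
    calabiE n t a = Real.exp (∑ l, calabiEps n a l * t l) := by
  unfold calabiE calabiEps
  congr 1
  refine Finset.sum_congr rfl fun l _ => ?_
  split_ifs <;> ring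

theorem calabiF_pos (hK : 0 < K) {m : ℕ} (hm : 0 < m) : 0 < calabiF n m := by
  unfold calabiF
  refine Finset.sum_pos' (fun b _ => by split_ifs <;> positivity) ⟨⟨0, hK⟩, Finset.mem_univ _, ?_⟩
  rw [if_pos hm]; positivity

theorem calabiF_lt_pos (l : Fin (K - 1)) : 0 < calabiF n (l.val + 1) :=
  calabiF_pos n (by have := l.isLt; omega) (Nat.succ_pos _)

theorem calabiF_succ (l : Fin (K - 1)) :
    calabiF n (l.val + 2) = calabiF n (l.val + 1) + ((n (attached l) : ℝ) + 1) := by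
  unfold calabiF
  rw [← sub_eq_iff_eq_add', ← Finset.sum_sub_distrib, Finset.sum_eq_single (attached l)]
  · simp [attached]
  · intro b _ hb
    have : b.val ≠ l.val + 1 := fun h => hb (Fin.ext h)
    by_cases h : b.val < l.val + 1
    · rw [if_pos (by omega), if_pos h, sub_self]
    · rw [if_neg (by omega), if_neg h, sub_self]
  · simp

theorem calabiF_top : calabiF n K = ∑ a, ((n a : ℝ) + 1) := by
  unfold calabiF
  exact Finset.sum_congr rfl fun b _ => if_pos b.isLt

theorem calabiNorm_eq (l : Fin (K - 1)) : calabiNorm n l =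
    calabiF n (l.val + 2) / (((n (attached l) : ℝ) + 1) * calabiF n (l.val + 1)) := by
  have := (calabiF_lt_pos n l).ne'
  have h : (n (attached l) : ℝ) + 1 ≠ 0 := by positivity
  rw [calabiNorm, calabiF_succ]
  field_simp
  ring

theorem calabiNorm_pos (l : Fin (K - 1)) : 0 < calabiNorm n l := by
  have := calabiF_lt_pos n l
  unfold calabiNorm
  positivity

theorem calabiEps_attached (l : Fin (K - 1)) :
    calabiEps n (attached l) l = -(1 / ((n (attached l) : ℝ) + 1)) := if_pos rfl

theorem calabiEps_of_le {a : Fin K} {l : Fin (K - 1)} (h : a.val ≤ l.val) :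
    calabiEps n a l = 1 / calabiF n (l.val + 1) := by
  rw [calabiEps, if_neg (by omega), if_pos h]

theorem calabiEps_of_gt {a : Fin K} {l : Fin (K - 1)} (h : l.val + 1 < a.val) :
    calabiEps n a l = 0 := by
  rw [calabiEps, if_neg (by omega), if_neg (by omega)]

/-- The weighted sum against `ε_λ` of a function that is constant on the first `λ` factors. -/
theorem sum_weight_eps (l : Fin (K - 1)) {ψ : Fin K → ℝ} {s : ℝ}
    (h : ∀ a : Fin K, a.val ≤ l.val → ψ a = s) :
    ∑ a, ((n a : ℝ) + 1) * calabiEps n a l * ψ a = s - ψ (attached l) := by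
  -- Weighted by `n_a + 1`, `ε_λ` has mass `1` on the first `λ` factors, whose total weight is
  -- `f_λ`, mass `-1` on the attached factor, and mass `0` on the later ones.
  have h1 : ∀ a : Fin K, ((n a : ℝ) + 1) * calabiEps n a l * ψ a =
      (if a.val < l.val + 1 then (n a : ℝ) + 1 else 0) * (s / calabiF n (l.val + 1)) +
        if a = attached l then -ψ (attached l) else 0 := by
    intro a
    rcases lt_trichotomy a.val (l.val + 1) with h2 | h2 | h2
    · rw [calabiEps_of_le n (by omega), h a (by omega), if_pos h2,
        if_neg (fun h => by simp [h, attached] at h2)]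
      ring
    · obtain rfl : a = attached l := Fin.ext h2
      rw [calabiEps_attached, if_neg (by simp [attached]), if_pos rfl]
      have : (n (attached l) : ℝ) + 1 ≠ 0 := by positivity
      field_simp
      ring
    · rw [calabiEps_of_gt n h2, if_neg (by omega),
        if_neg (fun h => by simp [h, attached] at h2)]
      ring
  rw [Finset.sum_congr rfl fun a _ => h1 a, Finset.sum_add_distrib, ← Finset.sum_mul]
  have h3 : ∑ a : Fin K, (if a.val < l.val + 1 then (n a : ℝ) + 1 else 0) =
    calabiF n (l.val + 1) := rfl
  have := (calabiF_lt_pos n l).ne'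
  rw [h3, Finset.sum_ite_eq' Finset.univ, if_pos (Finset.mem_univ _)]
  field_simp
  ring

theorem sum_eps (l : Fin (K - 1)) : ∑ a, ((n a : ℝ) + 1) * calabiEps n a l = 0 := by
  simpa using sum_weight_eps n l (ψ := fun _ => 1) (s := 1) fun _ _ => rfl

theorem calabiEps_const {l m : Fin (K - 1)} (h : l < m) {a : Fin K} (ha : a.val ≤ l.val + 1) :
    calabiEps n a m = 1 / calabiF n (m.val + 1) :=
  calabiEps_of_le n (ha.trans h)

/-- For `λ < μ`, `ε_μ` is constant on the support of `ε_λ`, and `ε_λ` has weighted sum zero. -/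
theorem sum_eps_eps (l m : Fin (K - 1)) :
    ∑ a, ((n a : ℝ) + 1) * (calabiEps n a l * calabiEps n a m) =
      if l = m then calabiNorm n l else 0 := by
  have key : ∀ l m : Fin (K - 1), l ≤ m →
      ∑ a, ((n a : ℝ) + 1) * (calabiEps n a l * calabiEps n a m) =
      if l = m then calabiNorm n l else 0 := by
    intro l m h
    simp only [← mul_assoc]
    rcases h.lt_or_eq with h | rfl
    · rw [sum_weight_eps n l fun a ha => calabiEps_const n h (Nat.le_succ_of_le ha),
        calabiEps_const n h (le_refl (l.val + 1)), sub_self, if_neg h.ne]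
    · rw [sum_weight_eps n l fun a ha => calabiEps_of_le n ha, calabiEps_attached, if_pos rfl,
        calabiNorm]
      ring
  rcases le_total l m with h | h
  · exact key l m h
  · have := key m l h
    simp only [mul_comm (calabiEps n _ m)] at this
    rw [this]
    by_cases hlm : l = m
    · subst hlm; simp
    · rw [if_neg hlm, if_neg (Ne.symm hlm)]

/-- The cubic coefficients `∑_a (n_a + 1) ε_{aλ} ε_{aμ} ε_{aν}`. -/
def calabiCubic (l m k : Fin (K - 1)) : ℝ :=
  ∑ a, ((n a : ℝ) + 1) * (calabiEps n a l * calabiEps n a m * calabiEps n a k)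

theorem calabiCubic_swap (l m k : Fin (K - 1)) : calabiCubic n l m k = calabiCubic n m l k := by
  simp only [calabiCubic, mul_comm (calabiEps n _ l)]

theorem calabiCubic_rotate (l m k : Fin (K - 1)) : calabiCubic n l m k = calabiCubic n m k l :=
  Finset.sum_congr rfl fun a _ => by ring

theorem calabiCubic_self (l : Fin (K - 1)) : calabiCubic n l l l =
    calabiNorm n l * (1 / calabiF n (l.val + 1) - 1 / ((n (attached l) : ℝ) + 1)) := by
  unfold calabiCubic
  simp only [fun w x y z : ℝ => show w * (x * y * z) = w * x * (y * z) by ring]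
  rw [sum_weight_eps n l fun a ha => by rw [calabiEps_of_le n ha], calabiEps_attached, calabiNorm]
  ring

theorem calabiCubic_of_lt {l m : Fin (K - 1)} (h : l < m) : calabiCubic n l l m =
    calabiNorm n l / calabiF n (m.val + 1) := by
  unfold calabiCubic
  simp only [fun w x y z : ℝ => show w * (x * y * z) = w * x * (y * z) by ring]
  rw [sum_weight_eps n l (fun a ha => by
      rw [calabiEps_of_le n ha, calabiEps_const n h (Nat.le_succ_of_le ha)]), calabiEps_attached,
    calabiEps_const n h (le_refl (l.val + 1)), calabiNorm]
  ring

/-- Here too the other two factors are constant on the support of `ε_λ`. Hence the cubic sum can be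
nonzero only if the smallest index is repeated. -/
theorem calabiCubic_eq_zero {l m k : Fin (K - 1)} (hm : l < m) (hk : l < k) :
    calabiCubic n l m k = 0 := by
  unfold calabiCubic
  simp only [fun w x y z : ℝ => show w * (x * y * z) = w * x * (y * z) by ring]
  rw [sum_weight_eps n l (fun a ha => by
      rw [calabiEps_const n hm (Nat.le_succ_of_le ha),
        calabiEps_const n hk (Nat.le_succ_of_le ha)]),
    calabiEps_const n hm (le_refl (l.val + 1)), calabiEps_const n hk (le_refl (l.val + 1)),
    sub_self]

/-- The orthogonal system `1, ε_1, …, ε_{K-1}` is complete. -/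
theorem eps_complete (hK : 0 < K) (a b : Fin K) :
    ∑ l, ((n a : ℝ) + 1) * calabiEps n a l * calabiEps n b l / calabiNorm n l +
      ((n a : ℝ) + 1) / calabiF n K = if a = b then 1 else 0 := by
  let P : Matrix (Option (Fin (K - 1))) (Fin K) ℝ :=
    Matrix.of fun o b => o.elim 1 fun l => calabiEps n b l
  let Q : Matrix (Fin K) (Option (Fin (K - 1))) ℝ :=
    Matrix.of fun a o => ((n a : ℝ) + 1) *
      o.elim (1 / calabiF n K) fun l => calabiEps n a l / calabiNorm n l
  have hf := (calabiF_pos n hK hK).ne'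
  have h1 : P * Q = 1 := by
    ext o p
    rw [Matrix.mul_apply]
    cases o with
    | none =>
      cases p with
      | none =>
        simp only [P, Q, Matrix.of_apply, Option.elim, one_mul, ← Finset.sum_mul]
        rw [← calabiF_top, Matrix.one_apply_eq]
        field_simp
      | some l =>
        have := sum_eps n l
        simp only [P, Q, Matrix.of_apply, Option.elim, one_mul, mul_div_assoc',
          ← Finset.sum_div]
        rw [this]; simp
    | some l =>
      cases p with
      | none =>
        have := sum_eps n l
        have h2 : ∀ a, calabiEps n a l * (((n a : ℝ) + 1) * (1 / calabiF n K)) =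
          ((n a : ℝ) + 1) * calabiEps n a l / calabiF n K := fun a => by ring
        simp only [P, Q, Matrix.of_apply, Option.elim, h2, ← Finset.sum_div]
        rw [this]; simp
      | some m =>
        have := sum_eps_eps n l m
        have h2 : ∀ a, calabiEps n a l * (((n a : ℝ) + 1) * (calabiEps n a m / calabiNorm n m)) =
          ((n a : ℝ) + 1) * (calabiEps n a l * calabiEps n a m) / calabiNorm n m :=
            fun a => by ring
        simp only [P, Q, Matrix.of_apply, Option.elim, h2, ← Finset.sum_div]
        rw [this]
        by_cases hlm : l = m
        · subst hlm; simp [(calabiNorm_pos n l).ne']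
        · simp [hlm]
  -- `P` is square up to the labelling of its rows, since there are `K` basis vectors; a one-sided
  -- inverse is therefore two-sided, and orthogonality turns into completeness.
  have h2 : Q * P = 1 :=
    (Matrix.mul_eq_one_comm_of_card_eq _ _ _ (by simp; omega)).1 h1
  have h3 := congrFun (congrFun h2 a) b
  rw [Matrix.mul_apply, Fintype.sum_option, Matrix.one_apply] at h3
  rw [← h3, add_comm]
  simp only [P, Q, Matrix.of_apply, Option.elim]
  congr 1
  · ring
  · exact Finset.sum_congr rfl fun l _ => by ring

end Weights

/-! ### Derivatives of block functions. -/

section Composition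

variable {K : ℕ} {n : Fin K → ℕ}

/-- `factorCoord` as a continuous linear map. -/
def factorProj (n : Fin K → ℕ) (a : Fin K) : (CalabiIndex n → ℝ) →L[ℝ] (Fin (n a) → ℝ) :=
  ContinuousLinearMap.pi fun i => ContinuousLinearMap.proj (vIdx a i)

/-- The exponent of `e_a` as a continuous linear function of the coordinates. -/
def exponent (n : Fin K → ℕ) (a : Fin K) : (CalabiIndex n → ℝ) →L[ℝ] ℝ :=
  ∑ l, calabiEps n a l • ContinuousLinearMap.proj (tIdx l)

theorem calabiE_eq_exp (u : CalabiIndex n → ℝ) (a : Fin K) :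
    calabiE n (fun l => u (tIdx l)) a = Real.exp (exponent n a u) := by
  rw [calabiE_eq]; simp [exponent]

/-- The vector function `(s_1 e_1 z_1, …, s_K e_K z_K)`. -/
def blockFun (s : Fin K → ℝ) (z : ∀ a, (Fin (n a) → ℝ) → Fin (n a + 1) → ℝ)
    (u : CalabiIndex n → ℝ) : (Σ a, Fin (n a + 1)) → ℝ :=
  fun k => s k.1 * calabiE n (fun l => u (tIdx l)) k.1 * z k.1 (factorCoord u k.1) k.2

theorem contDiff_calabiE (a : Fin K) :
    ContDiff ℝ ∞ (fun u : CalabiIndex n → ℝ => calabiE n (fun l => u (tIdx l)) a) := by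
  simp only [calabiE_eq_exp]
  exact (exponent n a).contDiff.exp

theorem pd_calabiE (p : CalabiIndex n) (a : Fin K) (u : CalabiIndex n → ℝ) :
    pd p (fun u => calabiE n (fun l => u (tIdx l)) a) u =
      exponent n a (Pi.single p 1) * calabiE n (fun l => u (tIdx l)) a := by
  simp only [calabiE_eq_exp, pd]
  rw [((exponent n a).hasFDerivAt.exp).fderiv]
  simp [mul_comm]

theorem exponent_single_t (a : Fin K) (l : Fin (K - 1)) :
    exponent n a (Pi.single (tIdx l) 1) = calabiEps n a l := by
  simp [exponent, Pi.single_apply]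

theorem exponent_single_v (a b : Fin K) (i : Fin (n b)) :
    exponent n a (Pi.single (vIdx b i) 1) = 0 := by
  simp [exponent]

theorem factorProj_single_t (a : Fin K) (l : Fin (K - 1)) :
    factorProj n a (Pi.single (tIdx l) 1) = 0 := by
  ext i; simp [factorProj]

theorem factorProj_single_v (b : Fin K) (i : Fin (n b)) :
    factorProj n b (Pi.single (vIdx b i) 1) = Pi.single i 1 := by
  ext j
  by_cases h : j = i
  · subst h; simp [factorProj]
  · simp [factorProj, h]

theorem factorProj_single_ne {a b : Fin K} (h : a ≠ b) (i : Fin (n b)) :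
    factorProj n a (Pi.single (vIdx b i) 1) = 0 := by
  ext j
  simp [factorProj, h]

theorem pd_comp_factor {F : Type*} [NormedAddCommGroup F] [NormedSpace ℝ F] {a : Fin K}
    {z : (Fin (n a) → ℝ) → F} {u : CalabiIndex n → ℝ}
    (hz : DifferentiableAt ℝ z (factorCoord u a)) (p : CalabiIndex n) :
    pd p (fun u => z (factorCoord u a)) u =
      fderiv ℝ z (factorCoord u a) (factorProj n a (Pi.single p 1)) := by
  have h : HasFDerivAt z (fderiv ℝ z (factorCoord u a)) (factorProj n a u) := hz.hasFDerivAt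
  rw [pd]
  have := (h.comp u (factorProj n a).hasFDerivAt).fderiv
  exact congrArg (fun T => T (Pi.single p 1)) this

theorem differentiableAt_comp_factor {F : Type*} [NormedAddCommGroup F] [NormedSpace ℝ F]
    {a : Fin K} {z : (Fin (n a) → ℝ) → F} {u : CalabiIndex n → ℝ}
    (hz : DifferentiableAt ℝ z (factorCoord u a)) :
    DifferentiableAt ℝ (fun u => z (factorCoord u a)) u :=
  DifferentiableAt.comp (f := factorProj n a) u hz (factorProj n a).differentiableAt

variable {s : Fin K → ℝ} {z : ∀ a, (Fin (n a) → ℝ) → Fin (n a + 1) → ℝ} {u : CalabiIndex n → ℝ}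

theorem pd_blockFun (hz : ∀ a, DifferentiableAt ℝ (z a) (factorCoord u a)) (p : CalabiIndex n)
    (a : Fin K) (q : Fin (n a + 1)) : pd p (blockFun s z) u ⟨a, q⟩ =
      s a * calabiE n (fun l => u (tIdx l)) a *
        (exponent n a (Pi.single p 1) * z a (factorCoord u a) q +
          fderiv ℝ (z a) (factorCoord u a) (factorProj n a (Pi.single p 1)) q) := by
  have hE : ∀ a, DifferentiableAt ℝ
      (fun u : CalabiIndex n → ℝ => s a * calabiE n (fun l => u (tIdx l)) a) u := fun a =>
    ((contDiff_calabiE a).differentiable (by simp) u).const_mul _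
  have hzq : ∀ a q, DifferentiableAt ℝ (fun u => z a (factorCoord u a) q) u := fun a q =>
    differentiableAt_pi.1 (differentiableAt_comp_factor (hz a)) q
  rw [pd_apply (f := blockFun s z) (differentiableAt_pi.2 fun k => (hE k.1).mul (hzq k.1 k.2))]
  simp only [blockFun]
  rw [pd_mul (hE a) (hzq a q), pd_const_mul _ ((contDiff_calabiE a).differentiable (by simp) u),
    pd_calabiE, ← pd_apply (differentiableAt_comp_factor (hz a)), pd_comp_factor (hz a)]
  ring

/-- Block functions are closed under differentiation: a `t`-derivative changes only the scalars `s`,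
a `v`-derivative only the functions `z`. Second derivatives come from applying these rules twice. -/
theorem pd_blockFun_t (hz : ∀ a, DifferentiableAt ℝ (z a) (factorCoord u a)) (l : Fin (K - 1)) :
    pd (tIdx l) (blockFun s z) u = blockFun (fun a => calabiEps n a l * s a) z u := by
  funext ⟨a, q⟩
  rw [pd_blockFun hz, exponent_single_t, factorProj_single_t]
  simp only [map_zero, Pi.zero_apply, blockFun]
  ring

theorem pd_blockFun_v (hz : ∀ a, DifferentiableAt ℝ (z a) (factorCoord u a)) (b : Fin K)
    (i : Fin (n b)) : pd (vIdx b i) (blockFun s z) u =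
      blockFun s (Function.update 0 b (pd i (z b))) u := by
  funext ⟨a, q⟩
  rw [pd_blockFun hz, exponent_single_v]
  by_cases h : a = b
  · subst h
    simp [factorProj_single_v, blockFun, pd]
  · simp [factorProj_single_ne h, blockFun, h]

theorem contDiffOn_blockFun {V : ∀ a, Set (Fin (n a) → ℝ)} (hz : ∀ a, ContDiffOn ℝ ∞ (z a) (V a)) :
    ContDiffOn ℝ ∞ (blockFun s z) {u | ∀ a, factorCoord u a ∈ V a} := by
  refine contDiffOn_pi.2 fun k => ?_
  refine (contDiffOn_const.mul (contDiff_calabiE k.1).contDiffOn).mul ?_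
  have h1 : ContDiffOn ℝ ∞ (fun u : CalabiIndex n → ℝ => z k.1 (factorProj n k.1 u))
      {u | ∀ a, factorCoord u a ∈ V a} :=
    (hz k.1).comp (factorProj n k.1).contDiff.contDiffOn fun u hu => hu k.1
  exact contDiffOn_pi.1 h1 k.2

theorem isOpen_productDomain {V : ∀ a, Set (Fin (n a) → ℝ)} (hV : ∀ a, IsOpen (V a)) :
    IsOpen {u : CalabiIndex n → ℝ | ∀ a, factorCoord u a ∈ V a} := by
  rw [Set.ofPred_forall]
  exact isOpen_iInter_of_finite fun a => (hV a).preimage (factorProj n a).continuous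

theorem det_blockDiagonal_sigma {m : Fin K → Type*} [∀ a, Fintype (m a)] [∀ a, DecidableEq (m a)]
    (d : ∀ a, Matrix (m a) (m a) ℝ) : (Matrix.blockDiagonal' d).det = ∏ a, (d a).det := by
  rw [(Matrix.blockTriangular_blockDiagonal' d).det_fintype]
  refine Finset.prod_congr rfl fun a _ => ?_
  rw [← Matrix.det_submatrix_equiv_self (Equiv.sigmaSubtype (β := m) a).symm]
  congr 1
  ext i j
  exact Matrix.blockDiagonal'_apply_eq d a i j

end Composition

/-! ### The frame of the composition and its determinant. -/

section CalabiFrame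

variable {K : ℕ} {n : Fin K → ℕ}

/-- The coefficients of the frame of the Calabi composition in the frames of the factors. -/
def calabiTransition (n : Fin K → ℕ) : Matrix (Option (CalabiIndex n)) (Σ a, Fin (n a + 1)) ℝ :=
  Matrix.of fun o k => ((stdOrder (n k.1)).symm k.2).elim
    (o.elim 1 (Sum.elim (fun l => calabiEps n k.1 l) fun _ => 0))
    (fun i => if o = some (vIdx k.1 i) then 1 else 0)

theorem sum_frameIndex (F : (Σ a : Fin K, Fin (n a + 1)) → ℝ) :
    ∑ k, F k = ∑ a, F ⟨a, stdOrder (n a) none⟩ + ∑ s : Σ a, Fin (n a),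
      F ⟨s.1, stdOrder (n s.1) (some s.2)⟩ := by
  rw [Fintype.sum_sigma, Fintype.sum_sigma, ← Finset.sum_add_distrib]
  refine Finset.sum_congr rfl fun a _ => ?_
  rw [← Equiv.sum_comp (stdOrder (n a)), Fintype.sum_option]

theorem prod_frameIndex (F : (Σ a : Fin K, Fin (n a + 1)) → ℝ) :
    ∏ k, F k = (∏ a, F ⟨a, stdOrder (n a) none⟩) * ∏ s : Σ a, Fin (n a),
      F ⟨s.1, stdOrder (n s.1) (some s.2)⟩ := by
  rw [Fintype.prod_sigma, Fintype.prod_sigma, ← Finset.prod_mul_distrib]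
  refine Finset.prod_congr rfl fun a _ => ?_
  rw [← Equiv.prod_comp (stdOrder (n a)), Fintype.prod_option]

/-- The basis relations in matrix form: with weight `n_a + 1` on the position vector of each factor
and `1` on its tangent vectors, the rows of the transition matrix are orthogonal. -/
theorem calabiTransition_gram (o o' : Option (CalabiIndex n)) :
    ∑ k : Σ a, Fin (n a + 1), calabiTransition n o k *
        ((stdOrder (n k.1)).symm k.2).elim ((n k.1 : ℝ) + 1) (fun _ => 1) *
        calabiTransition n o' k =
      if o = o' then o.elim (calabiF n K) (Sum.elim (calabiNorm n) fun _ => 1) else 0 := by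
  rw [sum_frameIndex]
  simp only [calabiTransition, Matrix.of_apply, Equiv.symm_apply_apply, Option.elim]
  rcases o with _ | l | s <;> rcases o' with _ | m | r
  · simp [calabiF_top]
  · simpa using sum_eps n m
  · simp
  · simpa [mul_comm] using sum_eps n l
  · have := sum_eps_eps n l m
    have h : ∀ a, calabiEps n a l * ((n a : ℝ) + 1) * calabiEps n a m =
      ((n a : ℝ) + 1) * (calabiEps n a l * calabiEps n a m) := fun a => by ring
    simp [h, this]
  · simp
  · simp
  · simp
  · simp only [Sum.elim_inr, zero_mul, Finset.sum_const_zero, zero_add, Option.some.injEq,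
      Sum.inr.injEq, Sigma.eta, mul_one, ite_mul, one_mul]
    by_cases h : s = r
    · subst h; simp
    · simp [Ne.symm h, h]

variable {c : Fin K → ℝ} {y : ∀ a, (Fin (n a) → ℝ) → Fin (n a + 1) → ℝ}
  {V : ∀ a, Set (Fin (n a) → ℝ)} {Γ : ∀ a, Fin (n a) → Fin (n a) → Fin (n a) → (Fin (n a) → ℝ) → ℝ}
  {G : ∀ a, (Fin (n a) → ℝ) → Matrix (Fin (n a)) (Fin (n a)) ℝ} {u : CalabiIndex n → ℝ}
  {e : Option (CalabiIndex n) ≃ Σ a : Fin K, Fin (n a + 1)}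

/-- Separates a constant matrix, depending only on the `n_a`, from the frames of the factors. -/
theorem frameMatrix_blockFun (hd : ∀ a, DifferentiableAt ℝ (y a) (factorCoord u a)) :
    frameMatrix e (blockFun c y) u (blockFun c y u) =
      (calabiTransition n).submatrix e.symm id * Matrix.blockDiagonal' fun a =>
        (c a * calabiE n (fun l => u (tIdx l)) a) •
          frameMatrix (stdOrder (n a)) (y a) (factorCoord u a) (y a (factorCoord u a)) := by
  ext p ⟨b, q⟩
  obtain ⟨o, rfl⟩ := e.surjective p
  rw [Matrix.mul_apply, Fintype.sum_sigma, Finset.sum_eq_single b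
    (fun a _ hab => Finset.sum_eq_zero fun r _ => by
      rw [Matrix.blockDiagonal'_apply_ne _ _ _ hab, mul_zero]) (by simp),
    ← Equiv.sum_comp (stdOrder (n b)), Fintype.sum_option]
  simp only [Matrix.blockDiagonal'_apply_eq, Matrix.smul_apply, frameMatrix_none, frameMatrix_some,
    Matrix.submatrix_apply, Equiv.symm_apply_apply, id, calabiTransition, Matrix.of_apply,
    Option.elim, smul_eq_mul]
  rcases o with _ | l | ⟨a, i⟩
  · simp [frameMatrix_none, blockFun]
  · simp only [frameMatrix_some]
    rw [pd_blockFun_t hd]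
    simp [blockFun, mul_assoc]
  · simp only [frameMatrix_some]
    rw [pd_blockFun_v hd]
    by_cases h : a = b
    · subst h
      simp [blockFun]
    · simp [blockFun, h, Ne.symm h]

/-- The exponents cancel because each `ε_λ` has weighted sum zero; this removes `t` from the frame
determinant. -/
theorem prod_calabiE_pow (t : Fin (K - 1) → ℝ) : ∏ a, calabiE n t a ^ (n a + 1) = 1 := by
  simp only [calabiE_eq, ← Real.exp_nat_mul, ← Real.exp_sum]
  rw [Real.exp_eq_one_iff]
  simp only [Finset.mul_sum]
  rw [Finset.sum_comm]
  refine Finset.sum_eq_zero fun l _ => ?_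
  have h : ∀ a, ((n a + 1 : ℕ) : ℝ) * (calabiEps n a l * t l) =
    ((n a : ℝ) + 1) * calabiEps n a l * t l := fun a => by push_cast; ring
  simp only [h, ← Finset.sum_mul, sum_eps, zero_mul]

/-- The squared determinant of the frame of a Calabi composition. -/
theorem frameDet_blockFun_sq (hd : ∀ a, DifferentiableAt ℝ (y a) (factorCoord u a)) :
    frameDet e (blockFun c y) u (blockFun c y u) ^ 2 * ∏ a, ((n a : ℝ) + 1) =
      calabiF n K * (∏ l, calabiNorm n l) * ∏ a, (c a ^ (2 * (n a + 1)) *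
        frameDet (stdOrder (n a)) (y a) (factorCoord u a) (y a (factorCoord u a)) ^ 2) := by
  let T : Matrix (Σ a, Fin (n a + 1)) (Σ a, Fin (n a + 1)) ℝ :=
    (calabiTransition n).submatrix e.symm id
  let W : (Σ a, Fin (n a + 1)) → ℝ := fun k =>
    ((stdOrder (n k.1)).symm k.2).elim ((n k.1 : ℝ) + 1) (fun _ => 1)
  have h1 : T * Matrix.diagonal W * T.transpose = Matrix.diagonal fun p =>
      (e.symm p).elim (calabiF n K) (Sum.elim (calabiNorm n) fun _ => 1) := by
    ext p r
    rw [Matrix.mul_apply]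
    simp only [Matrix.mul_diagonal, Matrix.transpose_apply, T, Matrix.submatrix_apply, id, W]
    rw [calabiTransition_gram, Matrix.diagonal_apply]
    simp only [EmbeddingLike.apply_eq_iff_eq]
  -- The determinant of the Gram identity. Taking the square makes the result independent of the
  -- ordering `e`.
  have h2 : T.det ^ 2 * ∏ a, ((n a : ℝ) + 1) = calabiF n K * ∏ l, calabiNorm n l := by
    have h3 := congrArg Matrix.det h1
    rw [Matrix.det_mul, Matrix.det_mul, Matrix.det_transpose, Matrix.det_diagonal,
      Matrix.det_diagonal, prod_frameIndex, ← Equiv.prod_comp e, Fintype.prod_option,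
      Fintype.prod_sum_type] at h3
    simp only [W, Equiv.symm_apply_apply, Option.elim, Finset.prod_const_one, mul_one,
      Sum.elim_inl, Sum.elim_inr] at h3
    rw [← h3]; ring
  have h4 : ∏ a, (c a * calabiE n (fun l => u (tIdx l)) a) ^ (n a + 1) =
      ∏ a, c a ^ (n a + 1) := by
    simp only [mul_pow, Finset.prod_mul_distrib, prod_calabiE_pow, mul_one]
  rw [frameDet, frameMatrix_blockFun hd, Matrix.det_mul, det_blockDiagonal_sigma]
  simp only [Matrix.det_smul, Fintype.card_fin, Finset.prod_mul_distrib, h4]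
  rw [← h2]
  simp only [mul_pow, frameDet, T, mul_comm 2, pow_mul, Finset.prod_pow]
  ring

theorem frame_sum (h : ∀ a, CentroaffineGauss (stdOrder (n a)) (y a) (V a) (Γ a) (G a))
    (hu : ∀ a, factorCoord u a ∈ V a) (cc : CalabiIndex n → ℝ) (g : ℝ) (b : Fin K) (q : Fin (n b + 1)) :
    (∑ s, cc s • pd s (blockFun c y) u + g • blockFun c y u) ⟨b, q⟩ =
      c b * calabiE n (fun l => u (tIdx l)) b *
        ((∑ l, cc (tIdx l) * calabiEps n b l + g) * y b (factorCoord u b) q +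
          ∑ k, cc (vIdx b k) * pd k (y b) (factorCoord u b) q) := by
  have hd : ∀ a, DifferentiableAt ℝ (y a) (factorCoord u a) := fun a =>
    (h a).diffAt (hu a) (h a).smooth
  rw [Fintype.sum_sum_type, Fintype.sum_sigma]
  simp only [pd_blockFun_t hd, pd_blockFun_v hd, Pi.add_apply, Finset.sum_apply, Pi.smul_apply,
    smul_eq_mul, blockFun]
  rw [Finset.sum_eq_single b (fun a _ hab => Finset.sum_eq_zero fun k _ => by
    simp [Ne.symm hab]) (by simp)]
  simp only [Function.update_self, mul_add, add_mul, Finset.mul_sum, Finset.sum_mul]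
  have e1 : ∀ l, cc (tIdx l) * (calabiEps n b l * c b * calabiE n (fun l => u (tIdx l)) b *
      y b (factorCoord u b) q) = c b * calabiE n (fun l => u (tIdx l)) b *
        (cc (tIdx l) * calabiEps n b l * y b (factorCoord u b) q) := fun l => by ring
  have e2 : ∀ k, cc (vIdx b k) * (c b * calabiE n (fun l => u (tIdx l)) b *
      pd k (y b) (factorCoord u b) q) = c b * calabiE n (fun l => u (tIdx l)) b *
        (cc (vIdx b k) * pd k (y b) (factorCoord u b) q) := fun k => by ring
  simp only [e1, e2]
  ring

end CalabiFrame

/-! ### Gauss coefficients of the composition. -/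

section CalabiGauss

variable {K : ℕ} {n : Fin K → ℕ}

/-- The Fourier expansion of the product `ε_λ ε_μ` in the orthogonal basis; the constant vector has
squared length `f_K`. -/
theorem cubic_expansion (hK : 0 < K) (b : Fin K) (l m : Fin (K - 1)) :
    ∑ k, calabiCubic n l m k / calabiNorm n k * calabiEps n b k +
      (if l = m then calabiNorm n l / calabiF n K else 0) = calabiEps n b l * calabiEps n b m := by
  have h1 : ∑ a, calabiEps n a l * calabiEps n a m *
      (∑ k, ((n a : ℝ) + 1) * calabiEps n a k * calabiEps n b k / calabiNorm n k +
        ((n a : ℝ) + 1) / calabiF n K) = calabiEps n b l * calabiEps n b m := by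
    simp [eps_complete n hK]
  rw [← h1]
  simp only [mul_add, Finset.sum_add_distrib, Finset.mul_sum]
  congr 1
  · rw [Finset.sum_comm]
    refine Finset.sum_congr rfl fun k _ => ?_
    rw [calabiCubic, Finset.sum_div, Finset.sum_mul]
    exact Finset.sum_congr rfl fun a _ => by ring
  · have h2 := sum_eps_eps n l m
    have h3 : ∀ a, calabiEps n a l * calabiEps n a m * (((n a : ℝ) + 1) / calabiF n K) =
      ((n a : ℝ) + 1) * (calabiEps n a l * calabiEps n a m) / calabiF n K := fun a => by ring
    rw [Finset.sum_congr rfl fun a _ => h3 a, ← Finset.sum_div, h2]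
    split_ifs <;> simp

variable {c : Fin K → ℝ} {y : ∀ a, (Fin (n a) → ℝ) → Fin (n a + 1) → ℝ}
  {V : ∀ a, Set (Fin (n a) → ℝ)} {Γ : ∀ a, Fin (n a) → Fin (n a) → Fin (n a) → (Fin (n a) → ℝ) → ℝ}
  {G : ∀ a, (Fin (n a) → ℝ) → Matrix (Fin (n a)) (Fin (n a)) ℝ} {u : CalabiIndex n → ℝ}
  {e : Option (CalabiIndex n) ≃ Σ a : Fin K, Fin (n a + 1)}
  {Γ' : CalabiIndex n → CalabiIndex n → CalabiIndex n → (CalabiIndex n → ℝ) → ℝ}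
  {G' : (CalabiIndex n → ℝ) → Matrix (CalabiIndex n) (CalabiIndex n) ℝ}

theorem exists_calabiGauss (hK : 0 < K) (hc : ∀ a, 0 < c a)
    (h : ∀ a, CentroaffineGauss (stdOrder (n a)) (y a) (V a) (Γ a) (G a)) :
    ∃ Γ' G', CentroaffineGauss e (blockFun c y) {u | ∀ a, factorCoord u a ∈ V a} Γ' G' := by
  refine exists_centroaffineGauss (isOpen_productDomain fun a => (h a).isOpen)
    (contDiffOn_blockFun fun a => (h a).smooth) fun u hu h0 => ?_
  have h1 := frameDet_blockFun_sq (c := c) (e := e) (y := y) (u := u) fun a =>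
    (h a).diffAt (hu a) (h a).smooth
  rw [h0, zero_pow two_ne_zero, zero_mul] at h1
  refine absurd h1.symm (mul_pos (mul_pos (calabiF_pos n hK hK)
    (Finset.prod_pos fun l _ => calabiNorm_pos n l)) (Finset.prod_pos fun a _ => ?_)).ne'
  have := (h a).det_ne _ (hu a)
  have := hc a
  positivity

/-- Second derivatives are computed block by block; by uniqueness of frame coefficients, a common
set of coefficients valid in every block is the Gauss equation. -/
theorem coeff_of_expansion
    (hX : CentroaffineGauss e (blockFun c y) {u | ∀ a, factorCoord u a ∈ V a} Γ' G')
    (h : ∀ a, CentroaffineGauss (stdOrder (n a)) (y a) (V a) (Γ a) (G a))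
    (hu : ∀ a, factorCoord u a ∈ V a) {p q : CalabiIndex n} (cc : CalabiIndex n → ℝ) (g : ℝ)
    (hexp : ∀ b r, pd p (pd q (blockFun c y)) u ⟨b, r⟩ = c b * calabiE n (fun l => u (tIdx l)) b *
        ((∑ l, cc (tIdx l) * calabiEps n b l + g) * y b (factorCoord u b) r +
          ∑ k, cc (vIdx b k) * pd k (y b) (factorCoord u b) r)) :
    (∀ s, Γ' s p q u = cc s) ∧ G' u p q = g := by
  have h1 := hX.gauss u hu p q
  have h2 : pd p (pd q (blockFun c y)) u =
      ∑ s, cc s • pd s (blockFun c y) u + g • blockFun c y u := by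
    funext ⟨b, r⟩
    rw [frame_sum h hu, hexp]
  have h3 := frame_coeff_unique (hX.det_ne u hu) (h1.symm.trans h2)
  exact ⟨fun s => congrFun h3.1 s, h3.2⟩

theorem calabi_tt (hK : 0 < K)
    (hX : CentroaffineGauss e (blockFun c y) {u | ∀ a, factorCoord u a ∈ V a} Γ' G')
    (h : ∀ a, CentroaffineGauss (stdOrder (n a)) (y a) (V a) (Γ a) (G a))
    (hu : ∀ a, factorCoord u a ∈ V a) (l m : Fin (K - 1)) :
    (∀ s, Γ' s (tIdx l) (tIdx m) u =
      (Sum.elim (fun k => calabiCubic n l m k / calabiNorm n k) 0 : CalabiIndex n → ℝ) s) ∧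
    G' u (tIdx l) (tIdx m) = if l = m then calabiNorm n l / calabiF n K else 0 := by
  refine coeff_of_expansion hX h hu _ _ fun b r => ?_
  have hd : ∀ v ∈ {u | ∀ a, factorCoord u a ∈ V a}, ∀ a, DifferentiableAt ℝ (y a)
    (factorCoord v a) := fun v hv a => (h a).diffAt (hv a) (h a).smooth
  rw [pd_congr hX.isOpen (fun v hv => pd_blockFun_t (s := c) (hd v hv) m) hu,
    pd_blockFun_t (hd u hu)]
  simp only [Sum.elim_inl, Sum.elim_inr, cubic_expansion hK]
  simp [blockFun]
  ring

theorem calabi_tv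
    (hX : CentroaffineGauss e (blockFun c y) {u | ∀ a, factorCoord u a ∈ V a} Γ' G')
    (h : ∀ a, CentroaffineGauss (stdOrder (n a)) (y a) (V a) (Γ a) (G a))
    (hu : ∀ a, factorCoord u a ∈ V a) (l : Fin (K - 1)) (a : Fin K) (j : Fin (n a)) :
    (∀ s, Γ' s (tIdx l) (vIdx a j) u =
      (Pi.single (vIdx a j) (calabiEps n a l) : CalabiIndex n → ℝ) s) ∧
    G' u (tIdx l) (vIdx a j) = 0 := by
  refine coeff_of_expansion hX h hu _ _ fun b r => ?_
  have hd : ∀ v ∈ {u | ∀ a, factorCoord u a ∈ V a}, ∀ a, DifferentiableAt ℝ (y a)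
    (factorCoord v a) := fun v hv a => (h a).diffAt (hv a) (h a).smooth
  have hd2 : ∀ b, DifferentiableAt ℝ
      ((Function.update 0 a (pd j (y a)) : ∀ a, (Fin (n a) → ℝ) → Fin (n a + 1) → ℝ) b)
      (factorCoord u b) := by
    intro b
    by_cases hab : b = a
    · subst hab
      rw [Function.update_self]
      exact (h b).diffAt (hu b) (contDiffOn_pd (h b).isOpen (h b).smooth j)
    · rw [Function.update_of_ne hab]; exact differentiableAt_const _
  rw [pd_congr hX.isOpen (fun v hv => pd_blockFun_v (s := c) (hd v hv) a j) hu,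
    pd_blockFun_t hd2]
  by_cases hab : b = a
  · subst hab
    rw [Finset.sum_eq_zero (fun l _ => by simp), Finset.sum_eq_single j]
    · simp [blockFun]; ring
    · intro k _ hk; simp [hk]
    · simp
  · simp [blockFun, hab]

theorem calabi_vv (hK : 0 < K)
    (hX : CentroaffineGauss e (blockFun c y) {u | ∀ a, factorCoord u a ∈ V a} Γ' G')
    (h : ∀ a, CentroaffineGauss (stdOrder (n a)) (y a) (V a) (Γ a) (G a))
    (hu : ∀ a, factorCoord u a ∈ V a) (a : Fin K) (i j : Fin (n a)) :
    (∀ s, Γ' s (vIdx a i) (vIdx a j) u =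
      (Sum.elim (fun k => G a (factorCoord u a) i j *
          (((n a : ℝ) + 1) * calabiEps n a k / calabiNorm n k)) fun s =>
        (Function.update 0 a (fun k => Γ a k i j (factorCoord u a)) :
          ∀ a, Fin (n a) → ℝ) s.1 s.2 : CalabiIndex n → ℝ) s) ∧
    G' u (vIdx a i) (vIdx a j) =
      G a (factorCoord u a) i j * (((n a : ℝ) + 1) / calabiF n K) := by
  refine coeff_of_expansion hX h hu _ _ fun b r => ?_
  have hd : ∀ v ∈ {u | ∀ a, factorCoord u a ∈ V a}, ∀ a, DifferentiableAt ℝ (y a)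
    (factorCoord v a) := fun v hv a => (h a).diffAt (hv a) (h a).smooth
  have hd2 : ∀ b, DifferentiableAt ℝ
      ((Function.update 0 a (pd j (y a)) : ∀ a, (Fin (n a) → ℝ) → Fin (n a + 1) → ℝ) b)
      (factorCoord u b) := by
    intro b
    by_cases hab : b = a
    · subst hab
      rw [Function.update_self]
      exact (h b).diffAt (hu b) (contDiffOn_pd (h b).isOpen (h b).smooth j)
    · rw [Function.update_of_ne hab]; exact differentiableAt_const _
  rw [pd_congr hX.isOpen (fun v hv => pd_blockFun_v (s := c) (hd v hv) a j) hu,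
    pd_blockFun_v hd2]
  -- The transversal term in the factor's Gauss equation is the position vector of block `a` alone.
  -- Completeness expands the indicator of `a`, giving components along all `∂_λ x` and along `x`.
  have h1 : ∑ l, (G a (factorCoord u a) i j *
      (((n a : ℝ) + 1) * calabiEps n a l / calabiNorm n l)) * calabiEps n b l +
        G a (factorCoord u a) i j * (((n a : ℝ) + 1) / calabiF n K) =
          G a (factorCoord u a) i j * if a = b then 1 else 0 := by
    rw [← eps_complete n hK, mul_add, Finset.mul_sum]
    congr 1
    exact Finset.sum_congr rfl fun l _ => by ring
  simp only [Sum.elim_inl, Sum.elim_inr, h1]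
  by_cases hab : b = a
  · subst hab
    have h2 := congrFun ((h b).gauss _ (hu b) i j) r
    simp only [Pi.add_apply, Finset.sum_apply, Pi.smul_apply, smul_eq_mul] at h2
    simp [blockFun, h2, add_comm]
  · simp [blockFun, hab, Ne.symm hab]

theorem calabi_vv_ne
    (hX : CentroaffineGauss e (blockFun c y) {u | ∀ a, factorCoord u a ∈ V a} Γ' G')
    (h : ∀ a, CentroaffineGauss (stdOrder (n a)) (y a) (V a) (Γ a) (G a))
    (hu : ∀ a, factorCoord u a ∈ V a) {a b : Fin K} (hab : a ≠ b) (i : Fin (n a))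
    (j : Fin (n b)) :
    (∀ s, Γ' s (vIdx a i) (vIdx b j) u = 0) ∧ G' u (vIdx a i) (vIdx b j) = 0 := by
  refine coeff_of_expansion hX h hu (fun _ => 0) _ fun d r => ?_
  have hd : ∀ v ∈ {u | ∀ a, factorCoord u a ∈ V a}, ∀ a, DifferentiableAt ℝ (y a)
    (factorCoord v a) := fun v hv a => (h a).diffAt (hv a) (h a).smooth
  have hd2 : ∀ d, DifferentiableAt ℝ
      ((Function.update 0 b (pd j (y b)) : ∀ a, (Fin (n a) → ℝ) → Fin (n a + 1) → ℝ) d)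
      (factorCoord u d) := by
    intro d
    by_cases hdb : d = b
    · subst hdb
      rw [Function.update_self]
      exact (h d).diffAt (hu d) (contDiffOn_pd (h d).isOpen (h d).smooth j)
    · rw [Function.update_of_ne hdb]; exact differentiableAt_const _
  rw [pd_congr hX.isOpen (fun v hv => pd_blockFun_v (s := c) (hd v hv) b j) hu,
    pd_blockFun_v hd2, Function.update_of_ne hab]
  have h0 : pd i (0 : (Fin (n a) → ℝ) → Fin (n a + 1) → ℝ) = 0 :=
    funext fun v => pd_const i 0
  rw [Pi.zero_apply, h0]
  by_cases hda : d = a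
  · subst hda; simp [blockFun]
  · simp [blockFun, hda]

end CalabiGauss

/-! ### The composition satisfies Țițeica's criterion. -/

section CalabiHypersphere

variable {K : ℕ} {n : Fin K → ℕ}
variable {c L : Fin K → ℝ} {y : ∀ a, (Fin (n a) → ℝ) → Fin (n a + 1) → ℝ}
  {V : ∀ a, Set (Fin (n a) → ℝ)} {Γ : ∀ a, Fin (n a) → Fin (n a) → Fin (n a) → (Fin (n a) → ℝ) → ℝ}
  {G : ∀ a, (Fin (n a) → ℝ) → Matrix (Fin (n a)) (Fin (n a)) ℝ} {u : CalabiIndex n → ℝ}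
  {e : Option (CalabiIndex n) ≃ Σ a : Fin K, Fin (n a + 1)}
  {Γ' : CalabiIndex n → CalabiIndex n → CalabiIndex n → (CalabiIndex n → ℝ) → ℝ}
  {G' : (CalabiIndex n → ℝ) → Matrix (CalabiIndex n) (CalabiIndex n) ℝ}

theorem calabi_vt
    (hX : CentroaffineGauss e (blockFun c y) {u | ∀ a, factorCoord u a ∈ V a} Γ' G')
    (h : ∀ a, CentroaffineGauss (stdOrder (n a)) (y a) (V a) (Γ a) (G a))
    (hu : ∀ a, factorCoord u a ∈ V a) (l : Fin (K - 1)) (a : Fin K) (j : Fin (n a)) :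
    (∀ s, Γ' s (vIdx a j) (tIdx l) u =
      (Pi.single (vIdx a j) (calabiEps n a l) : CalabiIndex n → ℝ) s) ∧
    G' u (vIdx a j) (tIdx l) = 0 := by
  have h1 := hX.symm hu (vIdx a j) (tIdx l)
  have h2 := calabi_tv hX h hu l a j
  exact ⟨fun s => (h1.1 s).trans (h2.1 s), h1.2.trans h2.2⟩

theorem calabiForm_eq (hK : 0 < K)
    (hX : CentroaffineGauss e (blockFun c y) {u | ∀ a, factorCoord u a ∈ V a} Γ' G')
    (h : ∀ a, CentroaffineGauss (stdOrder (n a)) (y a) (V a) (Γ a) (G a))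
    (hu : ∀ a, factorCoord u a ∈ V a) : G' u =
      Matrix.fromBlocks (Matrix.diagonal fun l => calabiNorm n l / calabiF n K) 0 0
        (Matrix.blockDiagonal' fun a => (((n a : ℝ) + 1) / calabiF n K) •
          G a (factorCoord u a)) := by
  ext p q
  rcases p with l | ⟨a, i⟩ <;> rcases q with m | ⟨b, j⟩
  · rw [(calabi_tt hK hX h hu l m).2, Matrix.fromBlocks_apply₁₁, Matrix.diagonal_apply]
  · exact (calabi_tv hX h hu l b j).2
  · exact (calabi_vt hX h hu m a i).2
  · rw [Matrix.fromBlocks_apply₂₂]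
    by_cases hab : a = b
    · subst hab
      rw [(calabi_vv hK hX h hu a i j).2, Matrix.blockDiagonal'_apply_eq, Matrix.smul_apply,
        smul_eq_mul, mul_comm]
    · rw [(calabi_vv_ne hX h hu hab i j).2, Matrix.blockDiagonal'_apply_ne _ _ _ hab]

theorem card_calabiIndex :
    Fintype.card (CalabiIndex n) = (K - 1) + ∑ a, n a := by
  simp

/-- Matches the exponent `1/(f_K + 1)` in `calabiC` with the power `n + 2` in the criterion. -/
theorem card_calabiIndex_add_one (hK : 2 ≤ K) :
    (Fintype.card (CalabiIndex n) : ℝ) + 1 = calabiF n K := by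
  rw [calabiF_top, Finset.sum_add_distrib, card_calabiIndex]
  push_cast [Nat.cast_sub (by omega : 1 ≤ K)]
  simp
  ring

theorem calabiC_pos (hK : 2 ≤ K) (hc : ∀ a, 0 < c a) (hL : ∀ a, L a < 0) : 0 < calabiC n c L := by
  have hf := calabiF_pos n (by omega : 0 < K) (by omega : 0 < K)
  refine Real.rpow_pos_of_pos (mul_pos (inv_pos.2 hf) (Finset.prod_pos fun a _ => ?_)) _
  have := neg_pos.2 (hL a)
  have := hc a
  positivity

theorem calabiC_pow (hK : 2 ≤ K) (hc : ∀ a, 0 < c a) (hL : ∀ a, L a < 0) :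
    calabiC n c L ^ (Fintype.card (CalabiIndex n) + 2) =
      (calabiF n K)⁻¹ * ∏ a, c a ^ (2 * (n a + 1)) /
        (((n a : ℝ) + 1) ^ (n a + 1) * (-L a) ^ (n a + 2)) := by
  have hf := calabiF_pos n (by omega : 0 < K) (by omega : 0 < K)
  have hB : 0 < (calabiF n K)⁻¹ * ∏ a, c a ^ (2 * (n a + 1)) /
      (((n a : ℝ) + 1) ^ (n a + 1) * (-L a) ^ (n a + 2)) := by
    refine mul_pos (inv_pos.2 hf) (Finset.prod_pos fun a _ => ?_)
    have := neg_pos.2 (hL a)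
    have := hc a
    positivity
  have h1 : ((Fintype.card (CalabiIndex n) + 2 : ℕ) : ℝ) = calabiF n K + 1 := by
    rw [← card_calabiIndex_add_one hK]; push_cast; ring
  rw [calabiC, ← Real.rpow_natCast, h1, ← Real.rpow_mul hB.le, one_div,
    inv_mul_cancel₀ (by positivity), Real.rpow_one]

/-- The origin of `C`. The squared lengths of the `ε_λ` and the frame determinants of the factors
cancel in `|det G'| / D²`. What remains is `f_K^{-(n+1)} ∏ (n_a+1)^{n_a+1} (-L_a)^{n_a+2} /
c_a^{2(n_a+1)}`, which is `(f_K C)^{-(n+2)}`. -/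
theorem abs_det_calabiForm (hK : 2 ≤ K) (hc : ∀ a, 0 < c a) (hL : ∀ a, L a < 0)
    (hX : CentroaffineGauss e (blockFun c y) {u | ∀ a, factorCoord u a ∈ V a} Γ' G')
    (h : ∀ a, CentroaffineGauss (stdOrder (n a)) (y a) (V a) (Γ a) (G a))
    (hdet : ∀ a, ∀ v ∈ V a, |(G a v).det| =
      frameDet (stdOrder (n a)) (y a) v (y a v) ^ 2 * (-L a) ^ (n a + 2))
    (hu : ∀ a, factorCoord u a ∈ V a) :
    |(G' u).det| = frameDet e (blockFun c y) u (blockFun c y u) ^ 2 *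
      (-(-(1 / (calabiF n K * calabiC n c L)))) ^ (Fintype.card (CalabiIndex n) + 2) := by
  have hf := calabiF_pos n (by omega : 0 < K) (by omega : 0 < K)
  have hD := frameDet_blockFun_sq (c := c) (e := e) (y := y) (u := u) fun a =>
    (h a).diffAt (hu a) (h a).smooth
  have hw : (0 : ℝ) < ∏ a, ((n a : ℝ) + 1) := Finset.prod_pos fun a _ => by positivity
  have hN : (0 : ℝ) < ∏ l, calabiNorm n l := Finset.prod_pos fun l _ => calabiNorm_pos n l
  rw [calabiForm_eq (by omega) hX h hu, Matrix.det_fromBlocks_zero₂₁, Matrix.det_diagonal,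
    det_blockDiagonal_sigma, neg_neg, div_pow, one_pow, mul_pow, calabiC_pow hK hc hL, abs_mul,
    Finset.prod_div_distrib, Finset.prod_const, Finset.card_univ, Fintype.card_fin,
    Finset.abs_prod]
  have h1 : ∀ a, |((((n a : ℝ) + 1) / calabiF n K) • G a (factorCoord u a)).det| =
      ((n a : ℝ) + 1) ^ n a * (frameDet (stdOrder (n a)) (y a) (factorCoord u a)
        (y a (factorCoord u a)) ^ 2 * (-L a) ^ (n a + 2)) / calabiF n K ^ n a := by
    intro a
    rw [Matrix.det_smul, abs_mul, hdet a _ (hu a), Fintype.card_fin, abs_of_pos (by positivity),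
      div_pow]
    ring
  simp only [h1]
  have hPb : 0 < ∏ a, c a ^ (2 * (n a + 1)) / (((n a : ℝ) + 1) ^ (n a + 1) *
      (-L a) ^ (n a + 2)) := Finset.prod_pos fun a _ => by
    have := neg_pos.2 (hL a)
    have := hc a
    positivity
  have h2 : (∏ a, ((n a : ℝ) + 1) ^ n a * (frameDet (stdOrder (n a)) (y a) (factorCoord u a)
        (y a (factorCoord u a)) ^ 2 * (-L a) ^ (n a + 2))) *
      (∏ a, c a ^ (2 * (n a + 1)) / (((n a : ℝ) + 1) ^ (n a + 1) * (-L a) ^ (n a + 2))) *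
      ∏ a, ((n a : ℝ) + 1) = ∏ a, (c a ^ (2 * (n a + 1)) *
        frameDet (stdOrder (n a)) (y a) (factorCoord u a) (y a (factorCoord u a)) ^ 2) := by
    rw [← Finset.prod_mul_distrib, ← Finset.prod_mul_distrib]
    refine Finset.prod_congr rfl fun a _ => ?_
    have := (neg_pos.2 (hL a)).ne'
    have : (n a : ℝ) + 1 ≠ 0 := by positivity
    field_simp
    ring
  rw [← h2] at hD
  have hD' := mul_right_cancel₀ hw.ne' (hD.trans (mul_assoc _ _ _).symm)
  rw [hD', Finset.prod_div_distrib, Finset.prod_pow_eq_pow_sum, abs_of_pos (by positivity),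
    card_calabiIndex, pow_add, pow_add]
  field_simp

/-- The Calabi composition is a hyperbolic affine hypersphere. -/
theorem calabi_hypersphere (hK : 2 ≤ K) (hc : ∀ a, 0 < c a) (hL : ∀ a, L a < 0)
    (hX : CentroaffineGauss e (blockFun c y) {u | ∀ a, factorCoord u a ∈ V a} Γ' G')
    (h : ∀ a, CentroaffineGauss (stdOrder (n a)) (y a) (V a) (Γ a) (G a))
    (hdet : ∀ a, ∀ v ∈ V a, |(G a v).det| =
      frameDet (stdOrder (n a)) (y a) v (y a v) ^ 2 * (-L a) ^ (n a + 2)) :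
    IsHyperbolicHypersphereOn e (blockFun c y) {u | ∀ a, factorCoord u a ∈ V a}
      (-(1 / (calabiF n K * calabiC n c L))) := by
  have : Nonempty (CalabiIndex n) := ⟨tIdx ⟨0, by omega⟩⟩
  have hf := calabiF_pos n (by omega : 0 < K) (by omega : 0 < K)
  have hC := calabiC_pos (n := n) hK hc hL
  exact hX.hypersphere_of_det (neg_neg_of_pos (by positivity)) fun v hv =>
    abs_det_calabiForm hK hc hL hX h hdet hv

/-! ### The cubic form of the composition, by type of index triple. -/

section CubicForm

theorem pd_comp_factorCoord {a : Fin K} {f : (Fin (n a) → ℝ) → ℝ}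
    (hf : DifferentiableAt ℝ f (factorCoord u a)) :
    (∀ l, pd (tIdx l) (fun u : CalabiIndex n → ℝ => f (factorCoord u a)) u = 0) ∧
    (∀ k, pd (vIdx a k) (fun u : CalabiIndex n → ℝ => f (factorCoord u a)) u =
      pd k f (factorCoord u a)) := by
  refine ⟨fun l => ?_, fun k => ?_⟩
  · rw [pd_comp_factor hf, factorProj_single_t, map_zero]
  · rw [pd_comp_factor hf, factorProj_single_v]; rfl

theorem sum_calabiForm_t (hK : 0 < K)
    (hX : CentroaffineGauss e (blockFun c y) {u | ∀ a, factorCoord u a ∈ V a} Γ' G')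
    (h : ∀ a, CentroaffineGauss (stdOrder (n a)) (y a) (V a) (Γ a) (G a))
    (hu : ∀ a, factorCoord u a ∈ V a) (l : Fin (K - 1)) (f : CalabiIndex n → ℝ) :
    ∑ s, G' u s (tIdx l) * f s = calabiNorm n l / calabiF n K * f (tIdx l) := by
  rw [Fintype.sum_sum_type, Finset.sum_eq_zero (s := (Finset.univ : Finset (Σ a, Fin (n a))))
    (fun s _ => by rw [(calabi_vt hX h hu l s.1 s.2).2, zero_mul])]
  simp [(calabi_tt hK hX h hu _ l).2]

theorem sum_calabiForm_v (hK : 0 < K)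
    (hX : CentroaffineGauss e (blockFun c y) {u | ∀ a, factorCoord u a ∈ V a} Γ' G')
    (h : ∀ a, CentroaffineGauss (stdOrder (n a)) (y a) (V a) (Γ a) (G a))
    (hu : ∀ a, factorCoord u a ∈ V a) (a : Fin K) (j : Fin (n a)) (f : CalabiIndex n → ℝ) :
    ∑ s, G' u s (vIdx a j) * f s = ((n a : ℝ) + 1) / calabiF n K *
      ∑ k, G a (factorCoord u a) k j * f (vIdx a k) := by
  rw [Fintype.sum_sum_type, Finset.sum_eq_zero (s := (Finset.univ : Finset (Fin (K - 1))))
    (fun l _ => by rw [(calabi_tv hX h hu l a j).2, zero_mul]), zero_add, Fintype.sum_sigma,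
    Finset.sum_eq_single a (fun b _ hba => Finset.sum_eq_zero fun k _ => by
      rw [(calabi_vv_ne hX h hu hba k j).2, zero_mul]) (by simp), Finset.mul_sum]
  refine Finset.sum_congr rfl fun k _ => ?_
  rw [(calabi_vv hK hX h hu a k j).2]
  ring

theorem cubicForm_eq
    (hX : CentroaffineGauss e (blockFun c y) {u | ∀ a, factorCoord u a ∈ V a} Γ' G')
    (hu : ∀ a, factorCoord u a ∈ V a) (p q r : CalabiIndex n) :
    cubicForm Γ' G' u p q r = pd r (fun v => G' v p q) u - ∑ s, G' u s q * Γ' s r p u -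
      ∑ s, G' u s p * Γ' s r q u := by
  rw [cubicForm]
  simp only [fun s => (hX.symm hu p s).2]

theorem cubicForm_ttt (hK : 0 < K)
    (hX : CentroaffineGauss e (blockFun c y) {u | ∀ a, factorCoord u a ∈ V a} Γ' G')
    (h : ∀ a, CentroaffineGauss (stdOrder (n a)) (y a) (V a) (Γ a) (G a))
    (hu : ∀ a, factorCoord u a ∈ V a) (l m k : Fin (K - 1)) :
    cubicForm Γ' G' u (tIdx l) (tIdx m) (tIdx k) = -(2 / calabiF n K) * calabiCubic n l m k := by
  rw [cubicForm_eq hX hu, sum_calabiForm_t hK hX h hu, sum_calabiForm_t hK hX h hu,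
    (calabi_tt hK hX h hu _ _).1, (calabi_tt hK hX h hu _ _).1,
    pd_congr hX.isOpen (fun v hv => (calabi_tt hK hX h hv l m).2) hu, pd_const]
  simp only [Sum.elim_inl]
  have h1 := (calabiNorm_pos n l).ne'
  have h2 := (calabiNorm_pos n m).ne'
  have h3 := (calabiF_pos n hK hK).ne'
  rw [calabiCubic_rotate n k l m, ← calabiCubic_rotate n l k m, calabiCubic_swap n l k m,
    calabiCubic_rotate n k l m]
  field_simp
  ring

theorem cubicForm_ttv (hK : 0 < K)
    (hX : CentroaffineGauss e (blockFun c y) {u | ∀ a, factorCoord u a ∈ V a} Γ' G')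
    (h : ∀ a, CentroaffineGauss (stdOrder (n a)) (y a) (V a) (Γ a) (G a))
    (hu : ∀ a, factorCoord u a ∈ V a) (l m : Fin (K - 1)) (a : Fin K) (i : Fin (n a)) :
    cubicForm Γ' G' u (tIdx l) (tIdx m) (vIdx a i) = 0 := by
  rw [cubicForm_eq hX hu, sum_calabiForm_t hK hX h hu, sum_calabiForm_t hK hX h hu,
    (calabi_vt hX h hu _ _ _).1, (calabi_vt hX h hu _ _ _).1,
    pd_congr hX.isOpen (fun v hv => (calabi_tt hK hX h hv l m).2) hu, pd_const]
  simp

theorem cubicForm_vvt (hK : 0 < K)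
    (hX : CentroaffineGauss e (blockFun c y) {u | ∀ a, factorCoord u a ∈ V a} Γ' G')
    (h : ∀ a, CentroaffineGauss (stdOrder (n a)) (y a) (V a) (Γ a) (G a))
    (hu : ∀ a, factorCoord u a ∈ V a) (a : Fin K) (i j : Fin (n a)) (l : Fin (K - 1)) :
    cubicForm Γ' G' u (vIdx a i) (vIdx a j) (tIdx l) =
      -(2 / calabiF n K) * (calabiEps n a l * ((n a : ℝ) + 1) * G a (factorCoord u a) i j) := by
  have hd := (h a).diffAt (hu a) ((h a).contDiffOn_form i j)
  rw [cubicForm_eq hX hu, sum_calabiForm_v hK hX h hu, sum_calabiForm_v hK hX h hu,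
    pd_congr hX.isOpen (fun v hv => (calabi_vv hK hX h hv a i j).2) hu,
    pd_mul (differentiableAt_comp_factor hd) (differentiableAt_const _), pd_const,
    (pd_comp_factorCoord hd).1]
  simp only [(calabi_tv hX h hu _ _ _).1]
  rw [Finset.sum_eq_single i (fun k _ hk => by simp [hk]) (by simp),
    Finset.sum_eq_single j (fun k _ hk => by simp [hk]) (by simp), ((h a).symm (hu a) j i).2]
  simp
  ring

theorem cubicForm_ne (hK : 0 < K)
    (hX : CentroaffineGauss e (blockFun c y) {u | ∀ a, factorCoord u a ∈ V a} Γ' G')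
    (h : ∀ a, CentroaffineGauss (stdOrder (n a)) (y a) (V a) (Γ a) (G a))
    (hu : ∀ a, factorCoord u a ∈ V a) {a b : Fin K} (hab : a ≠ b) (i : Fin (n a))
    (j : Fin (n b)) (r : CalabiIndex n) :
    cubicForm Γ' G' u (vIdx a i) (vIdx b j) r = 0 := by
  -- The connection never takes a tangent vector of one factor to a tangent vector of another,
  -- whatever the direction `r` of differentiation.
  have key : ∀ (a b : Fin K), a ≠ b → ∀ (i : Fin (n a)) (k : Fin (n b)),
      Γ' (vIdx b k) r (vIdx a i) u = 0 := by
    intro a b hab i k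
    rcases r with l | ⟨d, m⟩
    · rw [(calabi_tv hX h hu _ _ _).1, Pi.single_eq_of_ne]
      simp [Ne.symm hab]
    · by_cases hd : d = a
      · subst hd
        rw [(calabi_vv hK hX h hu _ _ _).1]
        simp [Ne.symm hab]
      · exact (calabi_vv_ne hX h hu hd m i).1 _
  rw [cubicForm_eq hX hu, sum_calabiForm_v hK hX h hu, sum_calabiForm_v hK hX h hu,
    pd_congr hX.isOpen (fun v hv => (calabi_vv_ne hX h hv hab i j).2) hu, pd_const]
  simp [key a b hab, key b a hab.symm]

theorem cubicForm_vvv (hK : 0 < K)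
    (hX : CentroaffineGauss e (blockFun c y) {u | ∀ a, factorCoord u a ∈ V a} Γ' G')
    (h : ∀ a, CentroaffineGauss (stdOrder (n a)) (y a) (V a) (Γ a) (G a))
    (hu : ∀ a, factorCoord u a ∈ V a) (a : Fin K) (i j k : Fin (n a)) :
    cubicForm Γ' G' u (vIdx a i) (vIdx a j) (vIdx a k) =
      ((n a : ℝ) + 1) / calabiF n K * cubicForm (Γ a) (G a) (factorCoord u a) i j k := by
  have hd := (h a).diffAt (hu a) ((h a).contDiffOn_form i j)
  rw [cubicForm_eq hX hu, sum_calabiForm_v hK hX h hu, sum_calabiForm_v hK hX h hu,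
    pd_congr hX.isOpen (fun v hv => (calabi_vv hK hX h hv a i j).2) hu,
    pd_mul (differentiableAt_comp_factor hd) (differentiableAt_const _), pd_const,
    (pd_comp_factorCoord hd).2]
  simp only [(calabi_vv hK hX h hu _ _ _).1, Sum.elim_inr, Function.update_self, cubicForm,
    fun l => ((h a).symm (hu a) i l).2]
  ring

end CubicForm

end CalabiHypersphere

/-! ### The data of a factor, including dimension zero. -/

section Factors

/-- The Gauss equation and the determinant identity are what the composition needs from its factors,
and they also cover points. For `n = 0` the affine normal is meaningless, but the empty determinant
is `1`, `D = 1` and `L = -1`, so the identity still holds. -/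
theorem centroaffineGauss_of_factor {n : ℕ} {M : Type*} [TopologicalSpace M]
    [ChartedSpace (Fin n → ℝ) M] [IsManifold 𝓘(ℝ, Fin n → ℝ) ∞ M]
    {x : M → Fin (n + 1) → ℝ} {L : ℝ} (hx : IsHyperbolicHypersphere n x L)
    {φ : OpenPartialHomeomorph M (Fin n → ℝ)}
    (hφ : φ ∈ IsManifold.maximalAtlas 𝓘(ℝ, Fin n → ℝ) ∞ M) :
    L < 0 ∧ ∃ Γ G, CentroaffineGauss (stdOrder n) (x ∘ φ.symm) φ.target Γ G ∧
      ∀ v ∈ φ.target, |(G v).det| =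
        frameDet (stdOrder n) (x ∘ φ.symm) v ((x ∘ φ.symm) v) ^ 2 * (-L) ^ (n + 2) := by
  rcases Nat.eq_zero_or_pos n with h0 | h0
  · subst h0
    obtain ⟨hx1, rfl⟩ := hx.point rfl
    have hy : x ∘ φ.symm = fun _ _ => 1 := funext fun v => hx1 _
    have hdet : ∀ v, frameDet (stdOrder 0) (x ∘ φ.symm) v ((x ∘ φ.symm) v) = 1 := by
      intro v
      have : Subsingleton (Fin (0 + 1)) := inferInstanceAs (Subsingleton (Fin 1))
      rw [frameDet, Matrix.det_eq_elem_of_subsingleton _ (stdOrder 0 none), frameMatrix_none, hy]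
    obtain ⟨Γ, G, h⟩ := exists_centroaffineGauss (e := stdOrder 0) (y := x ∘ φ.symm)
      φ.open_target (by rw [hy]; exact contDiffOn_const) fun v _ => by rw [hdet]; exact one_ne_zero
    refine ⟨by norm_num, Γ, G, h, fun v _ => ?_⟩
    rw [hdet]
    simp
  · have : Nonempty (Fin n) := ⟨⟨0, h0⟩⟩
    have hy := hx.hypersphere h0 φ hφ
    obtain ⟨Γ, G, h⟩ := CentroaffineGauss.exists_of_hypersphere φ.open_target hy
    refine ⟨hy.neg, Γ, G, h, fun v hv => ?_⟩
    have hG : ∀ v ∈ φ.target, (G v).det ≠ 0 := fun v hv =>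
      (h.det_form_ne_zero_iff hv).1 (hy.nondegenerate v hv)
    simpa using (h.metricRatio_mul_eq_one_iff hG hv (neg_pos.2 hy.neg)).1
      (h.affineNormal_of_hypersphere hy hv).2

end Factors

/-- None of the permutations of the triple `(p, q, r)` is listed. -/
def NotListed {K : ℕ} {n : Fin K → ℕ} (p q r : CalabiIndex n) : Prop :=
  ¬ IsListed p q r ∧ ¬ IsListed p r q ∧ ¬ IsListed q p r ∧ ¬ IsListed q r p ∧ ¬ IsListed r p q ∧
    ¬ IsListed r q p

theorem notListed_of_perm {K : ℕ} {n : Fin K → ℕ} {w : Fin 3 → CalabiIndex n}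
    (hw : ∀ σ : Equiv.Perm (Fin 3), ¬ IsListed (w (σ 0)) (w (σ 1)) (w (σ 2))) :
    NotListed (w 0) (w 1) (w 2) :=
  ⟨hw 1, hw (Equiv.swap 1 2), hw (Equiv.swap 0 1), hw (finRotate 3), hw (finRotate 3)⁻¹,
    hw (Equiv.swap 0 2)⟩

theorem NotListed.swap {K : ℕ} {n : Fin K → ℕ} {p q r : CalabiIndex n} (h : NotListed p q r) :
    NotListed q p r := by
  unfold NotListed at *; tauto

theorem NotListed.rotate {K : ℕ} {n : Fin K → ℕ} {p q r : CalabiIndex n} (h : NotListed p q r) :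
    NotListed q r p := by
  unfold NotListed at *; tauto

end

end AffineHypersurface

open AffineHypersurface
theorem mainTheorem4 {K : ℕ} (hK : 2 ≤ K) (n : Fin K → ℕ) {M : Fin K → Type*}
    [∀ a, TopologicalSpace (M a)] [∀ a, ChartedSpace (Fin (n a) → ℝ) (M a)]
    [∀ a, IsManifold 𝓘(ℝ, Fin (n a) → ℝ) ∞ (M a)]
    (x : ∀ a, M a → Fin (n a + 1) → ℝ) (L : Fin K → ℝ)
    (hx : ∀ a, IsHyperbolicHypersphere (n a) (x a) (L a))
    (c : Fin K → ℝ) (hc : ∀ a, 0 < c a)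
    -- local coordinates on the factors
    (φ : ∀ a, OpenPartialHomeomorph (M a) (Fin (n a) → ℝ))
    (hφ : ∀ a, φ a ∈ IsManifold.maximalAtlas 𝓘(ℝ, Fin (n a) → ℝ) ∞ (M a))
    -- an ordering of the ambient coordinates
    (e : Option (CalabiIndex n) ≃ Σ a : Fin K, Fin (n a + 1))
    -- the composition and its factors in local coordinates
    (X : (CalabiIndex n → ℝ) → (Σ a : Fin K, Fin (n a + 1)) → ℝ)
    (hX : X = calabiComposition n c x ∘ productParam φ)
    (y : ∀ a, (Fin (n a) → ℝ) → Fin (n a + 1) → ℝ)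
    (hy : ∀ a, y a = x a ∘ (φ a).symm)
    (U : Set (CalabiIndex n → ℝ))
    (hU : U = {u | ∀ a, factorCoord u a ∈ (φ a).target})
    (f : ℕ → ℝ) (hf : f = calabiF n) (C : ℝ) (hC : C = calabiC n c L) :
    IsHyperbolicHypersphereOn e X U (-(1 / (f K * C))) ∧
    ∀ u ∈ U, ∀ (g : Matrix (CalabiIndex n) (CalabiIndex n) ℝ)
      (A : CalabiIndex n → CalabiIndex n → CalabiIndex n → ℝ),
      g = affineMetric e X X u → A = fubiniPick e X X u →
      -- `A` is symmetric in its three indices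
      (∀ p q r, A p q r = A q p r ∧ A p q r = A p r q) ∧
      -- `A_{λλλ}`
      (∀ (l : Fin (K - 1)) (b : Fin K), b.val = l.val + 1 →
        A (tIdx l) (tIdx l) (tIdx l) =
          f (l.val + 2) * C / (((n b : ℝ) + 1) * f (l.val + 1)) *
            (1 / f (l.val + 1) - 1 / ((n b : ℝ) + 1))) ∧
      -- `A_{λλμ}`, `λ < μ`
      (∀ (l m : Fin (K - 1)) (b : Fin K), l < m → b.val = l.val + 1 →
        A (tIdx l) (tIdx l) (tIdx m) =
          f (l.val + 2) * C / (((n b : ℝ) + 1) * f (l.val + 1) * f (m.val + 1))) ∧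
      -- `A_{ī_a j̄_a λ}`, `λ = a - 1`
      (∀ (a : Fin K) (i j : Fin (n a)) (l : Fin (K - 1)), l.val + 1 = a.val →
        A (vIdx a i) (vIdx a j) (tIdx l) = -(1 / ((n a : ℝ) + 1)) * g (vIdx a i) (vIdx a j) ∧
        A (vIdx a i) (vIdx a j) (tIdx l) =
          L a * C * affineMetric (stdOrder (n a)) (y a) (y a) (factorCoord u a) i j) ∧
      -- `A_{ī_a j̄_a λ}`, `λ ≥ a`
      (∀ (a : Fin K) (i j : Fin (n a)) (l : Fin (K - 1)), a.val ≤ l.val →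
        A (vIdx a i) (vIdx a j) (tIdx l) = 1 / f (l.val + 1) * g (vIdx a i) (vIdx a j) ∧
        A (vIdx a i) (vIdx a j) (tIdx l) =
          ((n a : ℝ) + 1) * (-L a) * C / f (l.val + 1) *
            affineMetric (stdOrder (n a)) (y a) (y a) (factorCoord u a) i j) ∧
      -- `A_{ī_a j̄_a k̄_a}`
      (∀ (a : Fin K) (i j k : Fin (n a)),
        A (vIdx a i) (vIdx a j) (vIdx a k) =
          ((n a : ℝ) + 1) * (-L a) * C *
            fubiniPick (stdOrder (n a)) (y a) (y a) (factorCoord u a) i j k) ∧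
      -- all components whose indices are not a permutation of listed ones vanish
      (∀ w : Fin 3 → CalabiIndex n,
        (∀ σ : Equiv.Perm (Fin 3), ¬ IsListed (w (σ 0)) (w (σ 1)) (w (σ 2))) →
        A (w 0) (w 1) (w 2) = 0) := by
  subst hf hC hU
  obtain rfl : y = fun a => x a ∘ (φ a).symm := funext hy
  have hK0 : 0 < K := by omega
  choose hL Γ G h hdet using fun a => centroaffineGauss_of_factor (hx a) (hφ a)
  obtain rfl : X = blockFun c fun a => x a ∘ (φ a).symm := hX
  obtain ⟨Γ', G', hX'⟩ := exists_calabiGauss (e := e) hK0 hc h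
  have hhyp := calabi_hypersphere (e := e) hK hc hL hX' h hdet
  refine ⟨hhyp, fun u hu g A hg hA => ?_⟩
  have : Nonempty (CalabiIndex n) := ⟨tIdx ⟨0, by omega⟩⟩
  have hfK := calabiF_pos n hK0 hK0
  have hC := calabiC_pos (n := n) hK hc hL
  -- The factor is `1/(2L)` for the mean curvature `L = -1/(f_K C)`; likewise the ratio of the
  -- metrics below is `-1/L = f_K C`.
  have hA' : ∀ p q r, A p q r =
      -(calabiF n K * calabiC n c L / 2) * cubicForm Γ' G' u p q r := by
    intro p q r
    rw [hA, hX'.fubiniPick_eq hhyp hu]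
    congr 1
    field_simp
  have hratio : metricRatio e (blockFun c fun a => x a ∘ (φ a).symm) u =
      calabiF n K * calabiC n c L := by
    have h1 := (hX'.affineNormal_of_hypersphere hhyp hu).2
    field_simp at h1
    linarith
  have hgvv : ∀ a i j, g (vIdx a i) (vIdx a j) =
      calabiC n c L * (((n a : ℝ) + 1) * G a (factorCoord u a) i j) := by
    intro a i j
    rw [hg, hX'.affineMetric_eq hu, Matrix.smul_apply, hratio, (calabi_vv hK0 hX' h hu a i j).2,
      smul_eq_mul]
    field_simp
  -- An index in `Fin (n a)` witnesses that the factor is not a point, for which the hypersphere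
  -- equations are not available.
  have hya : ∀ a, Fin (n a) → IsHyperbolicHypersphereOn (stdOrder (n a)) (x a ∘ (φ a).symm)
      (φ a).target (L a) := fun a i => (hx a).hypersphere i.pos (φ a) (hφ a)
  have hga : ∀ a i j, (-L a) * affineMetric (stdOrder (n a)) (x a ∘ (φ a).symm)
      (x a ∘ (φ a).symm) (factorCoord u a) i j = G a (factorCoord u a) i j := by
    intro a i j
    have : Nonempty (Fin (n a)) := ⟨i⟩
    rw [(h a).affineMetric_eq (hu a), Matrix.smul_apply, smul_eq_mul, ← mul_assoc,
      mul_comm (-L a), ((h a).affineNormal_of_hypersphere (hya a i) (hu a)).2, one_mul]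
  have hsymm1 : ∀ p q r, A p q r = A q p r := fun p q r => by
    rw [hA', hA', hX'.cubicForm_swap hu]
  have hsymm2 : ∀ p q r, A p q r = A p r q := fun p q r => by
    rw [hA', hA', hX'.cubicForm_swap hu, hX'.cubicForm_rotate hu, hX'.cubicForm_swap hu]
  have hrot : ∀ p q r, A p q r = A q r p := fun p q r => by
    rw [hsymm1 p q r, hsymm2 q p r]
  have httt : ∀ l m k, A (tIdx l) (tIdx m) (tIdx k) = calabiC n c L * calabiCubic n l m k := by
    intro l m k
    rw [hA', cubicForm_ttt hK0 hX' h hu]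
    field_simp
  have httv : ∀ l m s, A (tIdx l) (tIdx m) (Sum.inr s) = 0 := by
    intro l m s
    rw [hA', cubicForm_ttv hK0 hX' h hu l m s.1 s.2, mul_zero]
  have hvvt : ∀ a i j l, A (vIdx a i) (vIdx a j) (tIdx l) =
      calabiEps n a l * (calabiC n c L * (((n a : ℝ) + 1) * G a (factorCoord u a) i j)) := by
    intro a i j l
    rw [hA', cubicForm_vvt hK0 hX' h hu]
    field_simp
  have hne : ∀ {a b : Fin K} (_ : a ≠ b) i j r, A (vIdx a i) (vIdx b j) r = 0 := by
    intro a b hab i j r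
    rw [hA', cubicForm_ne hK0 hX' h hu hab, mul_zero]
  refine ⟨fun p q r => ⟨hsymm1 p q r, hsymm2 p q r⟩, ?_, ?_, ?_, ?_, ?_, ?_⟩
  · intro l b hb
    obtain rfl : b = attached l := Fin.ext hb
    rw [httt, calabiCubic_self, calabiNorm_eq]
    ring
  · intro l m b hlm hb
    obtain rfl : b = attached l := Fin.ext hb
    rw [httt, calabiCubic_of_lt n hlm, calabiNorm_eq, div_div]
    ring
  · intro a i j l hl
    obtain rfl : a = attached l := Fin.ext hl.symm
    have hw : (n (attached l) : ℝ) + 1 ≠ 0 := by positivity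
    rw [hvvt, hgvv, calabiEps_attached]
    refine ⟨rfl, ?_⟩
    rw [← hga]
    field_simp
  · intro a i j l hl
    rw [hvvt, hgvv, calabiEps_of_le n hl]
    refine ⟨rfl, ?_⟩
    rw [← hga]
    ring
  · intro a i j k
    have : Nonempty (Fin (n a)) := ⟨i⟩
    have hLa := (hL a).ne
    rw [hA', cubicForm_vvv hK0 hX' h hu, (h a).fubiniPick_eq (hya a i) (hu a)]
    field_simp
  · intro w hw
    have hN := notListed_of_perm hw
    have zttt : ∀ l m k, NotListed (n := n) (tIdx l) (tIdx m) (tIdx k) →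
        A (tIdx l) (tIdx m) (tIdx k) = 0 := by
      intro l m k hN
      obtain ⟨h1, h2, h3, h4, h5, h6⟩ := hN
      rw [httt]
      -- If one of the three indices is strictly smaller than both others, the cubic sum vanishes.
      -- Otherwise the minimum is attained twice and some permutation of the triple is listed.
      by_cases c1 : l < m ∧ l < k
      · rw [calabiCubic_eq_zero n c1.1 c1.2, mul_zero]
      by_cases c2 : m < k ∧ m < l
      · rw [calabiCubic_rotate, calabiCubic_eq_zero n c2.1 c2.2, mul_zero]
      by_cases c3 : k < l ∧ k < m
      · rw [calabiCubic_rotate, calabiCubic_rotate, calabiCubic_eq_zero n c3.1 c3.2, mul_zero]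
      exfalso
      by_cases d1 : l = m
      · subst d1
        exact h1 (IsListed.ttt l k (by by_contra hh; exact c3 ⟨not_le.1 hh, not_le.1 hh⟩))
      by_cases d2 : l = k
      · subst d2
        exact h2 (IsListed.ttt l m (by by_contra hh; exact c2 ⟨not_le.1 hh, not_le.1 hh⟩))
      by_cases d3 : m = k
      · subst d3
        exact h4 (IsListed.ttt m l (by by_contra hh; exact c1 ⟨not_le.1 hh, not_le.1 hh⟩))
      omega
    have zvvt : ∀ s r l, NotListed (n := n) (Sum.inr s) (Sum.inr r) (tIdx l) →
        A (Sum.inr s) (Sum.inr r) (tIdx l) = 0 := by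
      rintro ⟨a, i⟩ ⟨b, j⟩ l hN
      by_cases hab : a = b
      · subst hab
        -- Not listed means `λ < a - 1`, which is exactly where `ε_{aλ}` vanishes.
        have h1 : l.val + 1 < a.val := by
          by_contra hh
          exact hN.1 (IsListed.vvt a i j l (not_lt.1 hh))
        rw [hvvt a i j l, calabiEps_of_gt n h1, zero_mul]
      · exact hne hab i j _
    have zvvv : ∀ s r q, NotListed (n := n) (Sum.inr s) (Sum.inr r) (Sum.inr q) →
        A (Sum.inr s) (Sum.inr r) (Sum.inr q) = 0 := by
      rintro ⟨a, i⟩ ⟨b, j⟩ ⟨d, k⟩ hN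
      by_cases hab : a = b
      · subst hab
        by_cases had : a = d
        · subst had
          exact absurd (IsListed.vvv a i j k) hN.1
        · rw [hrot]
          exact hne had j k _
      · exact hne hab i j _
    have key : ∀ p q r, NotListed (n := n) p q r → A p q r = 0 := by
      -- By symmetry of `A`, each of the eight type patterns is moved to one with the `t`-indices
      -- together in a standard position.
      rintro (l | s) (m | t) (k | q) hN
      · exact zttt l m k hN
      · exact httv l m q
      · rw [hsymm2]; exact httv l k t
      · rw [hrot]; exact zvvt t q l hN.rotate
      · rw [hrot]; exact httv m k s
      · rw [← hrot]; exact zvvt q s m hN.rotate.rotate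
      · exact zvvt s t k hN
      · exact zvvv s t q hN
    exact key _ _ _ hN
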